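/- Let $M$ be a compact $C^\infty$ Riemannian manifold without boundary, $(X_t)_{t\in\mathbb R}$ a $C^1$ flow on $M$ (i.e. $(t,x)\mapsto X_t(x)$ is $C^1$), and $X(x)=\frac{d}{dt}\big|_{t=0}X_t(x)$ its velocity field. Let $\Lambda\subseteq M$ be a compact invariant set with $X(x)\neq 0$ for all $x\in\Lambda$. For $x\in\Lambda$ let $N_x\subset T_xM$ be the orthogonal complement of $\langle X(x)\rangle$, let $N_\Lambda$ be the bundle over $\Lambda$ with fibres $N_x$, and let $P_t=\Pi\circ DX_t\colon N_x\to N_{X_t(x)}$ be the linear Poincaré flow, where $\Pi$ is the orthogonal projection onto the normal space. Let $(V,A_t)$ be either $(T_\Lambda M, DX_t)$ or $(N_\Lambda, P_t)$. A *partially hyperbolic splitting* of $(V,A_t)$ over $\Lambda$ is a splitting $V=E\oplus F$ into continuous $A_t$-invariant subbundles over $\Lambda$ (of locally constant rank) such that $E_x\ne\{0\}$ for all $x\in\Lambda$ and there are constants $K,C,\lambda,\mu>0$ with $$\|A_t|_{E_x}\|\cdot\|A_{-t}|_{F_{X_t(x)}}\|<Ke^{-\lambda t}\quad (x\in\Lambda,\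 t>0),\qquad \|A_t|_{E_x}\|\le Ce^{-\mu t}\quad (x\in\Lambda,\ t\ge 0),$$ where the norm of a linear map on the zero space is $0$. Then: 1. $\Lambda$ is partially hyperbolic for $X_t$, i.e. $(T_\Lambda M,DX_t)$ has a partially hyperbolic splitting $E\oplus F$ with $F_x\neq\{0\}$ for all $x\in\Lambda$, if and only if $P_t$ is partially hyperbolic on $\Lambda$ in the sense that $(N_\Lambda,P_t)$ has a partially hyperbolic splitting $\tilde E\oplus\tilde F$, where $\tilde F_x=\{0\}$ is allowed. 2. $(T_\Lambda M,DX_t)$ has a partially hyperbolic splitting $E\oplus F$ with $\dim F_x\ge 2$ for all $x\in\Lambda$ if and only if $(N_\Lambda,P_t)$ has a partially hyperbolic splitting $\tilde E\oplus\tilde F$ with $\tilde F_x\ne\{0\}$ for all $x\in\Lambda$. -/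

import Mathlib

open Set Filter Topology Manifold Bundle
open scoped ContDiff

noncomputable section

namespace FlowSplitting

variable {E : Type*} [NormedAddCommGroup E] [NormedSpace ℝ E]
  {M : Type*} [TopologicalSpace M] [ChartedSpace E M]

/-- A `C¹` flow on `M`: the map `(t, x) ↦ X_t(x)` is of class `C¹` on `ℝ × M`. -/
def IsC1Flow (φ : Flow ℝ M) : Prop :=
  ContMDiff (𝓘(ℝ, ℝ).prod 𝓘(ℝ, E)) 𝓘(ℝ, E) 1 (fun p : ℝ × M => φ p.1 p.2)

/-- The vector field `X` generates the flow: every orbit `t ↦ X_t(x)` is an integral curve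
of `X`. -/
def IsGeneratedBy (φ : Flow ℝ M) (X : ∀ x : M, TangentSpace 𝓘(ℝ, E) x) : Prop :=
  ∀ x : M, IsMIntegralCurve (I := 𝓘(ℝ, E)) (fun t : ℝ => φ t x) X

/-- The derivative `DX_t(x) : T_x M → T_{X_t(x)} M` of the time-`t` map of the flow. -/
def tangentFlow (φ : Flow ℝ M) (t : ℝ) (x : M) :
    TangentSpace 𝓘(ℝ, E) x →L[ℝ] TangentSpace 𝓘(ℝ, E) (φ t x) :=
  mfderiv 𝓘(ℝ, E) 𝓘(ℝ, E) (φ t) x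

/-- A family of subspaces `S_x ⊆ T_x M` is a continuous subbundle over `Λ`: near every point of
`Λ` there is a frame of `S` over `Λ` which consists of continuous sections. -/
def IsContinuousSubbundle [IsManifold 𝓘(ℝ, E) 1 M] (Λ : Set M)
    (S : ∀ x : M, Submodule ℝ (TangentSpace 𝓘(ℝ, E) x)) : Prop :=
  ∀ x ∈ Λ, ∃ U ∈ 𝓝 x, ∃ (k : ℕ) (s : Fin k → ∀ y : M, TangentSpace 𝓘(ℝ, E) y),
    (∀ i, ContinuousOn (fun y : M => (⟨y, s i y⟩ : TangentBundle 𝓘(ℝ, E) M)) (U ∩ Λ)) ∧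
    ∀ y ∈ U ∩ Λ, LinearIndependent ℝ (fun i => s i y) ∧
      Submodule.span ℝ (Set.range fun i => s i y) = S y

variable [RiemannianBundle (fun x : M => TangentSpace 𝓘(ℝ, E) x)]

/-- The normal space `N_x`: the orthogonal complement in `T_x M` of the line spanned by `X(x)`. -/
def normalSpace (X : ∀ x : M, TangentSpace 𝓘(ℝ, E) x) (x : M) :
    Submodule ℝ (TangentSpace 𝓘(ℝ, E) x) :=
  (Submodule.span ℝ {X x})ᗮ

/-- One can project onto the normal space, since it is the orthogonal complement of a line. -/
instance normalSpaceHasOrthogonalProjection (X : ∀ x : M, TangentSpace 𝓘(ℝ, E) x) (x : M) :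
    (normalSpace X x).HasOrthogonalProjection := by
  unfold normalSpace
  infer_instance

/-- The linear Poincaré flow `P_t = Π ∘ DX_t`, where `Π` is the orthogonal projection onto the
normal space. It takes values in the normal bundle, and is only ever used below on vectors of the
normal bundle. -/
def linearPoincareFlow (φ : Flow ℝ M) (X : ∀ x : M, TangentSpace 𝓘(ℝ, E) x) (t : ℝ) (x : M) :
    TangentSpace 𝓘(ℝ, E) x →L[ℝ] TangentSpace 𝓘(ℝ, E) (φ t x) :=
  (normalSpace X (φ t x)).starProjection ∘L tangentFlow φ t x

/-- The norm `‖L|_S‖ = sup {‖L v‖ : v ∈ S, ‖v‖ = 1}` of the restriction of a linear map between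
tangent spaces to a subspace (it is `0` if `S = 0`). -/
def normOn {x y : M} (L : TangentSpace 𝓘(ℝ, E) x →L[ℝ] TangentSpace 𝓘(ℝ, E) y)
    (S : Submodule ℝ (TangentSpace 𝓘(ℝ, E) x)) : ℝ :=
  ‖L ∘L S.subtypeL‖

/-- Let `A_t(x) : T_x M → T_{X_t(x)} M` be a family of linear maps over the flow (below: the
derivative of the flow, or the linear Poincaré flow). `V = S ⊕ C` is a continuous `A`-invariant
splitting over `Λ` of the bundle `V` (below: the tangent bundle, or the normal bundle). -/
structure IsInvariantSplitting [IsManifold 𝓘(ℝ, E) 1 M] (φ : Flow ℝ M)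
    (A : ∀ (t : ℝ) (x : M), TangentSpace 𝓘(ℝ, E) x →L[ℝ] TangentSpace 𝓘(ℝ, E) (φ t x))
    (Λ : Set M) (V S C : ∀ x : M, Submodule ℝ (TangentSpace 𝓘(ℝ, E) x)) : Prop where
  sup_eq : ∀ x ∈ Λ, S x ⊔ C x = V x
  disjoint : ∀ x ∈ Λ, Disjoint (S x) (C x)
  continuous_left : IsContinuousSubbundle Λ S
  continuous_right : IsContinuousSubbundle Λ C
  invariant_left : ∀ x ∈ Λ, ∀ t : ℝ,
    (S x).map (A t x : TangentSpace 𝓘(ℝ, E) x →ₗ[ℝ] TangentSpace 𝓘(ℝ, E) (φ t x)) = S (φ t x)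
  invariant_right : ∀ x ∈ Λ, ∀ t : ℝ,
    (C x).map (A t x : TangentSpace 𝓘(ℝ, E) x →ₗ[ℝ] TangentSpace 𝓘(ℝ, E) (φ t x)) = C (φ t x)

/-- The domination condition
`‖A_t|_{S_x}‖ · ‖A_{-t}|_{C_{X_t(x)}}‖ < K e^{-λ t}` for all `x ∈ Λ` and `t > 0`. -/
def IsDominated (φ : Flow ℝ M)
    (A : ∀ (t : ℝ) (x : M), TangentSpace 𝓘(ℝ, E) x →L[ℝ] TangentSpace 𝓘(ℝ, E) (φ t x))
    (Λ : Set M) (S C : ∀ x : M, Submodule ℝ (TangentSpace 𝓘(ℝ, E) x)) : Prop :=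
  ∃ K > (0 : ℝ), ∃ l > (0 : ℝ), ∀ x ∈ Λ, ∀ t : ℝ, 0 < t →
    normOn (A t x) (S x) * normOn (A (-t) (φ t x)) (C (φ t x)) < K * Real.exp (-l * t)

/-- `S` is uniformly contracted: `‖A_t|_{S_x}‖ ≤ K e^{-λ t}` for all `x ∈ Λ` and `t ≥ 0`. -/
def IsUniformlyContracted (φ : Flow ℝ M)
    (A : ∀ (t : ℝ) (x : M), TangentSpace 𝓘(ℝ, E) x →L[ℝ] TangentSpace 𝓘(ℝ, E) (φ t x))
    (Λ : Set M) (S : ∀ x : M, Submodule ℝ (TangentSpace 𝓘(ℝ, E) x)) : Prop :=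
  ∃ K > (0 : ℝ), ∃ l > (0 : ℝ), ∀ x ∈ Λ, ∀ t : ℝ, 0 ≤ t →
    normOn (A t x) (S x) ≤ K * Real.exp (-l * t)

/-- `V = S ⊕ C` is a partially hyperbolic splitting over `Λ`: a continuous invariant dominated
splitting whose first subbundle `S` is nonzero and uniformly contracted. Whether the central
subbundle `C` may vanish is said separately where this is used. -/
structure IsPartiallyHyperbolicSplitting [IsManifold 𝓘(ℝ, E) 1 M] (φ : Flow ℝ M)
    (A : ∀ (t : ℝ) (x : M), TangentSpace 𝓘(ℝ, E) x →L[ℝ] TangentSpace 𝓘(ℝ, E) (φ t x))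
    (Λ : Set M) (V S C : ∀ x : M, Submodule ℝ (TangentSpace 𝓘(ℝ, E) x)) : Prop where
  splitting : IsInvariantSplitting φ A Λ V S C
  dominated : IsDominated φ A Λ S C
  contracted : IsUniformlyContracted φ A Λ S
  left_ne_bot : ∀ x ∈ Λ, S x ≠ ⊥

/-- `T_Λ M = S ⊕ C` is a partially hyperbolic splitting for the flow, with `S` and `C` both
nonzero at every point of `Λ`. -/
def IsFlowPHSplitting [IsManifold 𝓘(ℝ, E) 1 M] (φ : Flow ℝ M) (Λ : Set M)
    (S C : ∀ x : M, Submodule ℝ (TangentSpace 𝓘(ℝ, E) x)) : Prop :=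
  IsPartiallyHyperbolicSplitting φ (tangentFlow φ) Λ (fun _ => ⊤) S C ∧ ∀ x ∈ Λ, C x ≠ ⊥

/-- `N = S ⊕ C` is a partially hyperbolic splitting over `Λ` for the linear Poincaré flow, with
`S` nonzero at every point of `Λ`; here `C` may vanish. -/
def IsPoincarePHSplitting [IsManifold 𝓘(ℝ, E) 1 M] (φ : Flow ℝ M)
    (X : ∀ x : M, TangentSpace 𝓘(ℝ, E) x) (Λ : Set M)
    (S C : ∀ x : M, Submodule ℝ (TangentSpace 𝓘(ℝ, E) x)) : Prop :=
  IsPartiallyHyperbolicSplitting φ (linearPoincareFlow φ X) Λ (normalSpace X) S C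

end FlowSplitting

end

namespace FlowSplitting

/-! ### Derivative cocycle of the flow and its generator. -/

section

variable {E : Type*} [NormedAddCommGroup E] [NormedSpace ℝ E]
  {M : Type*} [TopologicalSpace M] [ChartedSpace E M]

/-! Along `Λ` write `TM = N ⊕ ⟨X⟩`. Since `DX_t` carries `X` to `X`, it is triangular there: the
diagonal blocks are `P_t` and, in the frame `X`, the number `1`. The remaining entry is the `shear`
`σ_t(v)`, the coefficient of `DX_t v` along `X`, and it obeys the cocycle identity `σ_{t+s}(v) =
σ_s(v) + σ_t(P_s v)` (`shear_add`). Compactness of `Λ` bounds `‖X‖` from both sides, the projections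
of a continuous splitting, and the shear over bounded times.

From `DX_t` to `P_t`: the generator lies in `F` (`IsPartiallyHyperbolicSplitting.generator_mem`),
because its `E`-component at `x` is the image of the bounded `E`-component at `X_{-t}(x)`, which
`DX_t` contracts to zero as `t → ∞`. Hence `Π` is injective on `E` with uniformly bounded inverse
and maps `F` into itself, so all estimates pass to `ΠE ⊕ ΠF` up to a constant.

From `P_t` to `DX_t`: take `F = F̃ ⊕ ⟨X⟩` and let `E` be the graph over `Ẽ` of `v ↦ -lim σ_t(v) X`.
Contraction of `Ẽ` and the cocycle identity make this limit exponentially fast, hence bounded and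
continuous, and `E` inherits the contraction. For domination, the backward shear on `F̃` may grow,
but multiplied by `‖P_t|_Ẽ‖` it decays at half the common rate
(`IsPoincarePHSplitting.exists_shear_bound_right`); the direction `X` itself is dominated because
`Ẽ` is contracted.

The second equivalence uses the same constructions: `Π` kills exactly a line of `F`, so `dim F ≥ 2`
corresponds to `F̃ ≠ 0`. -/

lemma IsC1Flow.mdifferentiable {φ : Flow ℝ M} (hφ : IsC1Flow (E := E) φ) (t : ℝ) :
    MDifferentiable 𝓘(ℝ, E) 𝓘(ℝ, E) (φ t) := by
  have h : ContMDiff 𝓘(ℝ, E) 𝓘(ℝ, E) 1 (fun x : M => φ t x) :=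
    hφ.comp (contMDiff_const.prodMk contMDiff_id)
  exact h.mdifferentiable one_ne_zero

/-- The equality lives in the total space because `φ (t + s) x` and `φ t (φ s x)` are only
propositionally equal, so the two vectors have different types. -/
lemma IsC1Flow.tangentFlow_add {φ : Flow ℝ M} (hφ : IsC1Flow (E := E) φ) (s t : ℝ) (x : M)
    (v : TangentSpace 𝓘(ℝ, E) x) :
    (⟨φ (t + s) x, tangentFlow φ (t + s) x v⟩ : TangentBundle 𝓘(ℝ, E) M) =
      ⟨φ t (φ s x), tangentFlow φ t (φ s x) (tangentFlow φ s x v)⟩ := by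
  have h := tangentMap_comp_at (⟨x, v⟩ : TangentBundle 𝓘(ℝ, E) M)
    (hφ.mdifferentiable t (φ s x)) (hφ.mdifferentiable s x)
  have e : (φ t ∘ φ s : M → M) = φ (t + s) := by
    ext y
    exact (φ.map_add t s y).symm
  rw [e] at h
  exact h

lemma tangentFlow_zero (φ : Flow ℝ M) (x : M) (v : TangentSpace 𝓘(ℝ, E) x) :
    (⟨φ 0 x, tangentFlow φ 0 x v⟩ : TangentBundle 𝓘(ℝ, E) M) = ⟨x, v⟩ := by
  have e : (φ 0 : M → M) = id := by
    ext y
    exact φ.map_zero_apply y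
  have : tangentMap 𝓘(ℝ, E) 𝓘(ℝ, E) (φ 0) (⟨x, v⟩ : TangentBundle 𝓘(ℝ, E) M) = ⟨x, v⟩ := by
    rw [e, tangentMap_id]
    rfl
  exact this

/-- Differentiate `X_t ∘ X_s = X_s ∘ X_t` along an orbit at `s = 0`. -/
lemma IsC1Flow.tangentFlow_generator {φ : Flow ℝ M} (hφ : IsC1Flow (E := E) φ)
    {X : ∀ x : M, TangentSpace 𝓘(ℝ, E) x} (hX : IsGeneratedBy φ X) (t : ℝ) (x : M) :
    tangentFlow φ t x (X x) = X (φ t x) := by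
  have h0 := hX x 0
  have h1 : HasMFDerivAt 𝓘(ℝ, E) 𝓘(ℝ, E) (φ t) (φ 0 x) (mfderiv 𝓘(ℝ, E) 𝓘(ℝ, E) (φ t) (φ 0 x)) :=
    (hφ.mdifferentiable t _).hasMFDerivAt
  have h2 := h1.comp (0 : ℝ) h0
  have h3 := hX (φ t x) 0
  have e : (φ t ∘ fun s => φ s x) = fun s => φ s (φ t x) := by
    ext s
    simp only [Function.comp]
    rw [← φ.map_add, ← φ.map_add, add_comm]
  rw [e] at h2
  have h4 : (tangentFlow φ t (φ 0 x) (X (φ 0 x)) : E) = (X (φ 0 (φ t x)) : E) := by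
    have := congrArg (fun L : ℝ →L[ℝ] E => L 1) (hasMFDerivAt_unique h2 h3)
    have e (y : M) (w : TangentSpace 𝓘(ℝ, E) y) :
        (ContinuousLinearMap.smulRight (1 : ℝ →L[ℝ] ℝ) w) (1 : ℝ) = w := one_smul ℝ w
    refine Eq.trans ?_ (this.trans (e _ _))
    exact congrArg (tangentFlow φ t (φ 0 x)) (e _ _).symm
  rw [φ.map_zero_apply (φ t x), φ.map_zero_apply x] at h4
  exact h4

/-- This is the tangent map of `(t, x) ↦ X_t(x)` restricted to vectors with zero time component. -/
lemma IsC1Flow.continuous_tangentFlow [IsManifold 𝓘(ℝ, E) 1 M] {φ : Flow ℝ M}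
    (hφ : IsC1Flow (E := E) φ) :
    Continuous (fun q : ℝ × TangentBundle 𝓘(ℝ, E) M =>
      (⟨φ q.1 q.2.1, tangentFlow φ q.1 q.2.1 q.2.2⟩ : TangentBundle 𝓘(ℝ, E) M)) := by
  have h1 := (ContMDiff.continuous_tangentMap hφ le_rfl).comp
    (contMDiff_equivTangentBundleProd_symm (n := 0) (I := 𝓘(ℝ, ℝ)) (M := ℝ)
      (I' := 𝓘(ℝ, E)) (M' := M)).continuous
  have h2 : Continuous (fun t : ℝ => (⟨t, 0⟩ : TangentBundle 𝓘(ℝ, ℝ) ℝ)) :=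
    (Bundle.contMDiff_zeroSection ℝ (TangentSpace 𝓘(ℝ, ℝ) : ℝ → Type _) (IB := 𝓘(ℝ, ℝ))
      (n := 0)).continuous
  refine (h1.comp ((h2.comp continuous_fst).prodMk continuous_snd)).congr ?_
  rintro ⟨t, x, v⟩
  have h3 := tangentMap_comp_at (⟨x, v⟩ : TangentBundle 𝓘(ℝ, E) M)
    (f := fun y : M => (t, y)) (I' := 𝓘(ℝ, ℝ).prod 𝓘(ℝ, E)) (I'' := 𝓘(ℝ, E))
    (ContMDiff.mdifferentiable hφ one_ne_zero (t, x)) (mdifferentiableAt_const.prodMk mdifferentiableAt_id)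
  rw [tangentMap_prod_right] at h3
  exact h3.symm

/-- The generator is the image of the unit time vector at `t = 0` under the same tangent map. -/
lemma IsC1Flow.continuous_generator [IsManifold 𝓘(ℝ, E) 1 M] {φ : Flow ℝ M}
    (hφ : IsC1Flow (E := E) φ) {X : ∀ x : M, TangentSpace 𝓘(ℝ, E) x} (hX : IsGeneratedBy φ X) :
    Continuous (fun x : M => (⟨x, X x⟩ : TangentBundle 𝓘(ℝ, E) M)) := by
  have h1 := (ContMDiff.continuous_tangentMap hφ le_rfl).comp
    (contMDiff_equivTangentBundleProd_symm (n := 0) (I := 𝓘(ℝ, ℝ)) (M := ℝ)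
      (I' := 𝓘(ℝ, E)) (M' := M)).continuous
  have h2 : Continuous (fun x : M => (⟨x, 0⟩ : TangentBundle 𝓘(ℝ, E) M)) :=
    (Bundle.contMDiff_zeroSection ℝ (TangentSpace 𝓘(ℝ, E) : M → Type _) (IB := 𝓘(ℝ, E))
      (n := 0)).continuous
  refine (h1.comp ((continuous_const (y := (⟨0, 1⟩ : TangentBundle 𝓘(ℝ, ℝ) ℝ))).prodMk h2)).congr ?_
  intro x
  have h3 := tangentMap_comp_at (⟨0, 1⟩ : TangentBundle 𝓘(ℝ, ℝ) ℝ)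
    (f := fun t : ℝ => (t, x)) (I' := 𝓘(ℝ, ℝ).prod 𝓘(ℝ, E)) (I'' := 𝓘(ℝ, E))
    (ContMDiff.mdifferentiable hφ one_ne_zero (0, x)) (mdifferentiableAt_id.prodMk mdifferentiableAt_const)
  rw [tangentMap_prod_left] at h3
  refine h3.symm.trans ?_
  have h4 : tangentMap 𝓘(ℝ, ℝ) 𝓘(ℝ, E) (fun t : ℝ => φ t x) ⟨0, 1⟩ = ⟨φ 0 x, X (φ 0 x)⟩ := by
    simp only [tangentMap, (hX x 0).mfderiv]
    congr 1
    exact one_smul ℝ _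
  refine Eq.trans h4 ?_
  rw [φ.map_zero_apply x]

variable [RiemannianBundle (fun x : M => TangentSpace 𝓘(ℝ, E) x)]

/-- The coefficient of the component of `v` along `X x`. -/
noncomputable def axialCoeff (X : ∀ x : M, TangentSpace 𝓘(ℝ, E) x) (p : TangentBundle 𝓘(ℝ, E) M) : ℝ :=
  inner ℝ (X p.1) p.2 / ‖X p.1‖ ^ 2

lemma starProjection_normalSpace (X : ∀ x : M, TangentSpace 𝓘(ℝ, E) x) (x : M)
    (v : TangentSpace 𝓘(ℝ, E) x) :
    (normalSpace X x).starProjection v = v - axialCoeff X ⟨x, v⟩ • X x := by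
  have : (normalSpace X x).starProjection v = v - (Submodule.span ℝ {X x}).starProjection v := by
    simp [normalSpace, Submodule.starProjection_orthogonal]
  rw [this, Submodule.starProjection_singleton]
  rfl

end

/-! ### Continuous sections and uniform independence of frames. -/

section

variable {E : Type*} [NormedAddCommGroup E] [NormedSpace ℝ E]
  {M : Type*} [TopologicalSpace M] [ChartedSpace E M]

section Continuity

variable [IsManifold 𝓘(ℝ, E) 1 M]

lemma continuousOn_section_add {s : Set M} {v w : ∀ x : M, TangentSpace 𝓘(ℝ, E) x}
    (hv : ContinuousOn (fun x : M => (⟨x, v x⟩ : TangentBundle 𝓘(ℝ, E) M)) s)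
    (hw : ContinuousOn (fun x : M => (⟨x, w x⟩ : TangentBundle 𝓘(ℝ, E) M)) s) :
    ContinuousOn (fun x : M => (⟨x, v x + w x⟩ : TangentBundle 𝓘(ℝ, E) M)) s := by
  rw [← contMDiffOn_zero_iff (I := 𝓘(ℝ, E)) (I' := 𝓘(ℝ, E).tangent)] at *
  exact ContMDiffOn.add_section hv hw

lemma continuousOn_section_smul {s : Set M} {a : M → ℝ} {v : ∀ x : M, TangentSpace 𝓘(ℝ, E) x}
    (ha : ContinuousOn a s)
    (hv : ContinuousOn (fun x : M => (⟨x, v x⟩ : TangentBundle 𝓘(ℝ, E) M)) s) :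
    ContinuousOn (fun x : M => (⟨x, a x • v x⟩ : TangentBundle 𝓘(ℝ, E) M)) s := by
  rw [← contMDiffOn_zero_iff (I := 𝓘(ℝ, E)) (I' := 𝓘(ℝ, E).tangent)] at hv ⊢
  rw [← contMDiffOn_zero_iff (I := 𝓘(ℝ, E)) (I' := 𝓘(ℝ, ℝ))] at ha
  exact ContMDiffOn.smul_section ha hv

variable [RiemannianBundle (fun x : M => TangentSpace 𝓘(ℝ, E) x)]
  [IsContinuousRiemannianBundle E (fun x : M => TangentSpace 𝓘(ℝ, E) x)]
  {Z : Type*} [TopologicalSpace Z] {s : Set Z} {f : Z → M}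

lemma continuousOn_norm_bundle {v : ∀ z : Z, TangentSpace 𝓘(ℝ, E) (f z)}
    (hv : ContinuousOn (fun z => (⟨f z, v z⟩ : TangentBundle 𝓘(ℝ, E) M)) s) :
    ContinuousOn (fun z => ‖v z‖) s := by
  have h := ContinuousOn.inner_bundle hv hv
  refine (Real.continuous_sqrt.comp_continuousOn h).congr fun z _ => ?_
  simp only [Function.comp, real_inner_self_eq_norm_sq]
  exact (Real.sqrt_sq (norm_nonneg _)).symm

lemma continuousOn_axialCoeff {X : ∀ x : M, TangentSpace 𝓘(ℝ, E) x}
    (hX : Continuous (fun x : M => (⟨x, X x⟩ : TangentBundle 𝓘(ℝ, E) M)))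
    {v : ∀ z : Z, TangentSpace 𝓘(ℝ, E) (f z)} (h0 : ∀ z ∈ s, X (f z) ≠ 0)
    (hv : ContinuousOn (fun z => (⟨f z, v z⟩ : TangentBundle 𝓘(ℝ, E) M)) s) :
    ContinuousOn (fun z => axialCoeff X (⟨f z, v z⟩ : TangentBundle 𝓘(ℝ, E) M)) s := by
  have hf : ContinuousOn f s :=
    (FiberBundle.continuous_proj E (TangentSpace 𝓘(ℝ, E) : M → Type _)).comp_continuousOn hv
  have hXf : ContinuousOn (fun z => (⟨f z, X (f z)⟩ : TangentBundle 𝓘(ℝ, E) M)) s :=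
    hX.comp_continuousOn hf
  refine (ContinuousOn.inner_bundle hXf hv).div ((continuousOn_norm_bundle hXf).pow 2) ?_
  intro z hz
  exact pow_ne_zero 2 (norm_ne_zero_iff.2 (h0 z hz))

/-- A frame of continuous sections is uniformly independent near each point. -/
lemma eventually_norm_le_of_linearIndependent {Λ U : Set M} {x : M} (hx : x ∈ Λ) (hU : U ∈ 𝓝 x)
    {ι : Type*} [Fintype ι] {u : ι → ∀ y : M, TangentSpace 𝓘(ℝ, E) y}
    (hu : ∀ i, ContinuousOn (fun y : M => (⟨y, u i y⟩ : TangentBundle 𝓘(ℝ, E) M)) (U ∩ Λ))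
    (hli : LinearIndependent ℝ (fun i => u i x)) :
    ∃ c : ℝ, 0 < c ∧ ∀ᶠ y in 𝓝[Λ] x, ∀ a : ι → ℝ, ‖a‖ ≤ c * ‖∑ i, a i • u i y‖ := by
  have hxm : x ∈ U ∩ Λ := ⟨mem_of_mem_nhds hU, hx⟩
  have hn : 𝓝[U ∩ Λ] x = 𝓝[Λ] x := by
    rw [inter_comm]; exact nhdsWithin_inter_of_mem' (mem_nhdsWithin_of_mem_nhds hU)
  -- The Gram form of the frame, jointly continuous in base point and coefficients; a positive lower
  -- bound on the unit sphere at `x` survives nearby.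
  set g : M × (ι → ℝ) → ℝ :=
    fun q => ∑ i, ∑ j, q.2 i * (q.2 j * inner ℝ (u i q.1) (u j q.1)) with hg
  have hgn (y : M) (a : ι → ℝ) : g (y, a) = ‖∑ i, a i • u i y‖ ^ 2 := by
    rw [← real_inner_self_eq_norm_sq]
    rw [sum_inner]
    simp only [hg, inner_sum, real_inner_smul_left, real_inner_smul_right]
    exact Finset.sum_congr rfl fun i _ => Finset.sum_congr rfl fun j _ => mul_left_comm _ _ _
  have hgc : ContinuousOn g ((U ∩ Λ) ×ˢ univ) := by
    refine continuousOn_finsetSum _ fun i _ => continuousOn_finsetSum _ fun j _ => ?_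
    have h1 (i : ι) : Continuous fun q : M × (ι → ℝ) => q.2 i := by fun_prop
    refine (h1 i).continuousOn.mul ((h1 j).continuousOn.mul ?_)
    exact (ContinuousOn.inner_bundle (hu i) (hu j)).comp continuousOn_fst fun q hq => hq.1
  have hK : IsCompact (Metric.sphere (0 : ι → ℝ) 1) := isCompact_sphere _ _
  -- The sphere is empty exactly for a frame of rank zero.
  rcases (Metric.sphere (0 : ι → ℝ) 1).eq_empty_or_nonempty with hemp | hne
  · refine ⟨1, one_pos, Eventually.of_forall fun y a => ?_⟩
    have : a = 0 := by
      by_contra h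
      have : ‖a‖⁻¹ • a ∈ (∅ : Set (ι → ℝ)) := by
        rw [← hemp]
        simp [norm_smul, h]
      exact this
    subst this
    simp
  have hpos : ∀ a ∈ Metric.sphere (0 : ι → ℝ) 1, 0 < g (x, a) := by
    intro a ha
    rw [hgn]
    refine pow_pos (norm_pos_iff.2 fun h => ?_) 2
    have : a = 0 := funext fun i => Fintype.linearIndependent_iff.1 hli a h i
    simp [this] at ha
  obtain ⟨a₀, ha₀, hmin⟩ := hK.exists_isMinOn hne
    (f := fun a => g (x, a)) (hgc.comp (by fun_prop) fun a _ => ⟨hxm, mem_univ _⟩)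
  set δ := g (x, a₀) / 2
  have hδ0 : 0 < δ := half_pos (hpos a₀ ha₀)
  -- Tube lemma: compactness of the sphere gives one neighbourhood of `x` for all coefficient
  -- vectors.
  have hev : ∀ᶠ y in 𝓝[Λ] x, ∀ a ∈ Metric.sphere (0 : ι → ℝ) 1, δ < g (y, a) := by
    rw [← hn]
    refine hK.induction_on (p := fun S => ∀ᶠ y in 𝓝[U ∩ Λ] x, ∀ a ∈ S, δ < g (y, a)) (by simp)
      (fun S T hST hT => hT.mono fun y hy a ha => hy a (hST ha))
      (fun S T hS hT => (hS.and hT).mono fun y hy a ha => ha.elim (hy.1 a) (hy.2 a)) fun a ha => ?_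
    have h1 : g (x, a) ∈ Ioi δ := lt_of_lt_of_le (half_lt_self (hpos a₀ ha₀)) (hmin ha)
    have h2 := (hgc (x, a) ⟨hxm, mem_univ _⟩).tendsto (Ioi_mem_nhds h1)
    rw [nhdsWithin_prod_eq, nhdsWithin_univ] at h2
    obtain ⟨p, hp, q, hq, hpq⟩ := Filter.mem_prod_iff.1 h2
    exact ⟨q, mem_nhdsWithin_of_mem_nhds hq, mem_of_superset hp fun y hy b hb => hpq ⟨hy, hb⟩⟩
  refine ⟨(Real.sqrt δ)⁻¹, inv_pos.2 (Real.sqrt_pos.2 hδ0), hev.mono fun y hy a => ?_⟩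
  rcases eq_or_ne a 0 with rfl | ha
  · simp
  have ha' : 0 < ‖a‖ := norm_pos_iff.2 ha
  have h1 := hy (‖a‖⁻¹ • a) (by simp [norm_smul, ha'.ne'])
  rw [hgn] at h1
  have h2 : ∑ i, (‖a‖⁻¹ • a) i • u i y = ‖a‖⁻¹ • ∑ i, a i • u i y := by
    simp [Finset.smul_sum, smul_smul]
  rw [h2, norm_smul, norm_inv, norm_norm] at h1
  have h3 : Real.sqrt δ ≤ ‖a‖⁻¹ * ‖∑ i, a i • u i y‖ :=
    Real.sqrt_le_iff.2 ⟨by positivity, h1.le⟩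
  rw [le_inv_mul_iff₀ (Real.sqrt_pos.2 hδ0)]
  rw [le_inv_mul_iff₀ ha'] at h3
  linarith

end Continuity

end

/-! ### Uniform bounds over the compact set. -/

section

variable {E : Type*} [NormedAddCommGroup E] [NormedSpace ℝ E]
  {M : Type*} [TopologicalSpace M] [ChartedSpace E M]

variable [IsManifold 𝓘(ℝ, E) 1 M] [RiemannianBundle (fun x : M => TangentSpace 𝓘(ℝ, E) x)]
  [IsContinuousRiemannianBundle E (fun x : M => TangentSpace 𝓘(ℝ, E) x)]

lemma exists_norm_bounds {X : ∀ x : M, TangentSpace 𝓘(ℝ, E) x}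
    (hX : Continuous (fun x : M => (⟨x, X x⟩ : TangentBundle 𝓘(ℝ, E) M))) {Λ : Set M}
    (hΛ : IsCompact Λ) (h0 : ∀ x ∈ Λ, X x ≠ 0) :
    ∃ m > (0 : ℝ), ∃ D > (0 : ℝ), ∀ x ∈ Λ, m ≤ ‖X x‖ ∧ ‖X x‖ ≤ D := by
  have hc : ContinuousOn (fun x => ‖X x‖) Λ := continuousOn_norm_bundle hX.continuousOn
  rcases Λ.eq_empty_or_nonempty with rfl | hne
  · exact ⟨1, one_pos, 1, one_pos, fun x hx => hx.elim⟩
  obtain ⟨x₀, hx₀, h₀⟩ := hΛ.exists_isMinOn hne hc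
  obtain ⟨x₁, hx₁, h₁⟩ := hΛ.exists_isMaxOn hne hc
  exact ⟨‖X x₀‖, norm_pos_iff.2 (h0 x₀ hx₀), ‖X x₁‖, norm_pos_iff.2 (h0 x₁ hx₁),
    fun x hx => ⟨h₀ hx, h₁ hx⟩⟩

/-- The derivative of the flow is bounded on a continuous subbundle, locally uniformly in time. -/
lemma IsContinuousSubbundle.exists_tangentFlow_bound {φ : Flow ℝ M}
    (hφ : IsC1Flow (E := E) φ) {Λ : Set M} (hΛ : IsCompact Λ)
    {S : ∀ x : M, Submodule ℝ (TangentSpace 𝓘(ℝ, E) x)} (hS : IsContinuousSubbundle Λ S) (T : ℝ) :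
    ∃ B > (0 : ℝ), ∀ t ∈ Icc (-T) T, ∀ x ∈ Λ, ∀ v ∈ S x, ‖tangentFlow φ t x v‖ ≤ B * ‖v‖ := by
  have hK : IsCompact (Icc (-T) T ×ˢ Λ) := isCompact_Icc.prod hΛ
  suffices h : ∃ B > (0 : ℝ), ∀ q ∈ Icc (-T) T ×ˢ Λ, q.2 ∈ Λ → ∀ v ∈ S q.2,
      ‖tangentFlow φ q.1 q.2 v‖ ≤ B * ‖v‖ by
    obtain ⟨B, hB, h⟩ := h
    exact ⟨B, hB, fun t ht x hx v hv => h (t, x) ⟨ht, hx⟩ hx v hv⟩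
  refine hK.induction_on (p := fun A : Set (ℝ × M) => ∃ B > (0 : ℝ), ∀ q ∈ A, q.2 ∈ Λ → ∀ v ∈ S q.2,
      ‖tangentFlow φ q.1 q.2 v‖ ≤ B * ‖v‖) ⟨1, one_pos, by simp⟩ ?_ ?_ ?_
  · rintro A A' hA ⟨B, hB, h⟩
    exact ⟨B, hB, fun q hq => h q (hA hq)⟩
  · rintro A A' ⟨B, hB, h⟩ ⟨B', hB', h'⟩
    refine ⟨max B B', lt_max_of_lt_left hB, fun q hq hqΛ v hv => ?_⟩
    rcases hq with hq | hq
    · exact (h q hq hqΛ v hv).trans (by gcongr; exact le_max_left _ _)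
    · exact (h' q hq hqΛ v hv).trans (by gcongr; exact le_max_right _ _)
  rintro ⟨t, x⟩ ⟨ht, hx : x ∈ Λ⟩
  obtain ⟨U, hU, k, u, hu, hspan⟩ := hS x hx
  have hxU : x ∈ U ∩ Λ := ⟨mem_of_mem_nhds hU, hx⟩
  have hn : 𝓝[U ∩ Λ] x = 𝓝[Λ] x := by
    rw [inter_comm]; exact nhdsWithin_inter_of_mem' (mem_nhdsWithin_of_mem_nhds hU)
  obtain ⟨c, hc, hc'⟩ := eventually_norm_le_of_linearIndependent hx hU hu (hspan x hxU).1
  have hD (i : Fin k) : ContinuousOn (fun q : ℝ × M => ‖tangentFlow φ q.1 q.2 (u i q.2)‖)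
      (univ ×ˢ (U ∩ Λ)) := by
    refine continuousOn_norm_bundle (f := fun q : ℝ × M => φ q.1 q.2) ?_
    refine hφ.continuous_tangentFlow.comp_continuousOn
      (f := fun q : ℝ × M => (q.1, (⟨q.2, u i q.2⟩ : TangentBundle 𝓘(ℝ, E) M))) ?_
    exact continuousOn_fst.prodMk ((hu i).comp continuousOn_snd fun q hq => hq.2)
  have hD' : ∀ᶠ q in 𝓝 t ×ˢ 𝓝[Λ] x, ∀ i, ‖tangentFlow φ q.1 q.2 (u i q.2)‖ <
      ‖tangentFlow φ t x (u i x)‖ + 1 := by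
    rw [eventually_all]
    intro i
    have := (hD i (t, x) ⟨mem_univ _, hxU⟩).tendsto (Iio_mem_nhds (lt_add_one _))
    rwa [nhdsWithin_prod_eq, nhdsWithin_univ, hn] at this
  have hloc : ∀ᶠ q in 𝓝 t ×ˢ 𝓝[Λ] x, q.2 ∈ U ∩ Λ := by
    refine tendsto_snd.eventually ?_
    rw [← hn]
    exact self_mem_nhdsWithin
  -- The summand `1` keeps the constant positive when the rank is zero.
  refine ⟨_, ?_, c * ∑ i, (‖tangentFlow φ t x (u i x)‖ + 1) + 1, by positivity, fun q hq hqΛ => hq⟩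
  rw [nhdsWithin_prod_eq]
  have hle : 𝓝[Icc (-T) T] t ×ˢ 𝓝[Λ] x ≤ 𝓝 t ×ˢ 𝓝[Λ] x :=
    Filter.prod_mono nhdsWithin_le_nhds le_rfl
  refine hle ?_
  filter_upwards [hD', hloc, tendsto_snd.eventually hc'] with q h1 h2 h3 v hv
  rw [← (hspan q.2 h2).2, Submodule.mem_span_range_iff_exists_fun] at hv
  obtain ⟨a, rfl⟩ := hv
  rw [map_sum]
  refine (norm_sum_le _ _).trans ?_
  calc ∑ i, ‖tangentFlow φ q.1 q.2 (a i • u i q.2)‖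
      ≤ ∑ i, (c * ‖∑ j, a j • u j q.2‖) * (‖tangentFlow φ t x (u i x)‖ + 1) := by
        refine Finset.sum_le_sum fun i _ => ?_
        rw [map_smul, norm_smul]
        exact mul_le_mul ((norm_le_pi_norm a i).trans (h3 a)) (h1 i).le (norm_nonneg _)
          (by positivity)
    _ = (c * ∑ i, (‖tangentFlow φ t x (u i x)‖ + 1)) * ‖∑ j, a j • u j q.2‖ := by
        rw [← Finset.mul_sum]; ring
    _ ≤ _ := by
        gcongr
        linarith

/-- The projection onto the first summand of a continuous splitting is bounded. -/
lemma exists_norm_le_norm_add {Λ : Set M} (hΛ : IsCompact Λ)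
    {S C : ∀ x : M, Submodule ℝ (TangentSpace 𝓘(ℝ, E) x)} (hS : IsContinuousSubbundle Λ S)
    (hC : IsContinuousSubbundle Λ C) (hd : ∀ x ∈ Λ, Disjoint (S x) (C x)) :
    ∃ c > (0 : ℝ), ∀ x ∈ Λ, ∀ v ∈ S x, ∀ w ∈ C x, ‖v‖ ≤ c * ‖v + w‖ := by
  suffices h : ∃ c > (0 : ℝ), ∀ x ∈ Λ, x ∈ Λ → ∀ v ∈ S x, ∀ w ∈ C x, ‖v‖ ≤ c * ‖v + w‖ by
    obtain ⟨B, hB, h⟩ := h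
    exact ⟨B, hB, fun x hx => h x hx hx⟩
  refine hΛ.induction_on (p := fun A : Set M => ∃ c > (0 : ℝ), ∀ x ∈ A, x ∈ Λ →
    ∀ v ∈ S x, ∀ w ∈ C x, ‖v‖ ≤ c * ‖v + w‖) ⟨1, one_pos, by simp⟩ ?_ ?_ ?_
  · rintro A A' hA ⟨B, hB, h⟩
    exact ⟨B, hB, fun q hq => h q (hA hq)⟩
  · rintro A A' ⟨B, hB, h⟩ ⟨B', hB', h'⟩
    refine ⟨max B B', lt_max_of_lt_left hB, fun q hq hqΛ v hv w hw => ?_⟩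
    rcases hq with hq | hq
    · exact (h q hq hqΛ v hv w hw).trans (by gcongr; exact le_max_left _ _)
    · exact (h' q hq hqΛ v hv w hw).trans (by gcongr; exact le_max_right _ _)
  intro x hx
  obtain ⟨U, hU, k, u, hu, hspan⟩ := hS x hx
  obtain ⟨U', hU', k', u', hu', hspan'⟩ := hC x hx
  have hUU : U ∩ U' ∈ 𝓝 x := inter_mem hU hU'
  have hxU : x ∈ U ∩ U' ∩ Λ := ⟨mem_of_mem_nhds hUU, hx⟩
  have hn : 𝓝[U ∩ U' ∩ Λ] x = 𝓝[Λ] x := by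
    rw [inter_comm]; exact nhdsWithin_inter_of_mem' (mem_nhdsWithin_of_mem_nhds hUU)
  -- Disjointness makes the joined frames independent at `x`, so near `x` the coefficients of `v`
  -- are controlled by `‖v + w‖`.
  let w : Fin k ⊕ Fin k' → ∀ y : M, TangentSpace 𝓘(ℝ, E) y := Sum.elim u u'
  have hw (i : Fin k ⊕ Fin k') : ContinuousOn
      (fun y : M => (⟨y, w i y⟩ : TangentBundle 𝓘(ℝ, E) M)) (U ∩ U' ∩ Λ) := by
    rcases i with i | i
    · exact (hu i).mono fun y hy => ⟨hy.1.1, hy.2⟩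
    · exact (hu' i).mono fun y hy => ⟨hy.1.2, hy.2⟩
  have hwi : LinearIndependent ℝ fun i => w i x := by
    have h1 := (hspan x ⟨hxU.1.1, hx⟩)
    have h2 := (hspan' x ⟨hxU.1.2, hx⟩)
    have h3 := h1.1.sum_type h2.1 (by rw [h1.2, h2.2]; exact hd x hx)
    have h4 : (fun i => w i x) = Sum.elim (fun i => u i x) (fun i => u' i x) := by
      ext i
      rcases i with i | i <;> rfl
    rw [h4]
    exact h3
  obtain ⟨c, hc, hc'⟩ := eventually_norm_le_of_linearIndependent hx hUU hw hwi
  have hD' : ∀ᶠ y in 𝓝[Λ] x, ∀ i, ‖u i y‖ < ‖u i x‖ + 1 := by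
    rw [eventually_all]
    intro i
    have := (continuousOn_norm_bundle (hw (Sum.inl i)) x hxU).tendsto (Iio_mem_nhds (lt_add_one _))
    rwa [hn] at this
  have hloc : ∀ᶠ y in 𝓝[Λ] x, y ∈ U ∩ U' ∩ Λ := by
    rw [← hn]
    exact self_mem_nhdsWithin
  refine ⟨_, ?_, c * ∑ i, (‖u i x‖ + 1) + 1, by positivity, fun q hq hqΛ => hq⟩
  filter_upwards [hD', hloc, hc'] with y h1 h2 h3 v hv v' hv'
  rw [← (hspan y ⟨h2.1.1, h2.2⟩).2, Submodule.mem_span_range_iff_exists_fun] at hv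
  rw [← (hspan' y ⟨h2.1.2, h2.2⟩).2, Submodule.mem_span_range_iff_exists_fun] at hv'
  obtain ⟨a, rfl⟩ := hv
  obtain ⟨a', rfl⟩ := hv'
  have h4 := h3 (Sum.elim a a')
  simp only [Fintype.sum_sum_type, Sum.elim_inl, Sum.elim_inr, w] at h4
  set N := ‖∑ i, a i • u i y + ∑ i, a' i • u' i y‖ with hN
  refine (norm_sum_le _ _).trans ?_
  calc ∑ i, ‖a i • u i y‖ ≤ ∑ i, (c * N) * (‖u i x‖ + 1) := by
        refine Finset.sum_le_sum fun i _ => ?_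
        rw [norm_smul]
        exact mul_le_mul ((norm_le_pi_norm (Sum.elim a a') (Sum.inl i)).trans h4) (h1 i).le
          (norm_nonneg _) (by positivity)
    _ = (c * ∑ i, (‖u i x‖ + 1)) * N := by
        rw [← Finset.mul_sum]; ring
    _ ≤ _ := by
        gcongr
        linarith

end

/-! ### Restricted norms, normal projection and the shear cocycle. -/

section

variable {E : Type*} [NormedAddCommGroup E] [NormedSpace ℝ E]
  {M : Type*} [TopologicalSpace M] [ChartedSpace E M]

/-- An inclusion for all times, negative ones included, is an equality: a preimage of `w` is
`DX_{-t} w`. -/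
lemma map_tangentFlow_eq {φ : Flow ℝ M} (hφ : IsC1Flow (E := E) φ) {Λ : Set M}
    (hΛ : IsInvariant φ Λ) {S : ∀ x : M, Submodule ℝ (TangentSpace 𝓘(ℝ, E) x)}
    (h : ∀ x ∈ Λ, ∀ t : ℝ, ∀ v ∈ S x, tangentFlow φ t x v ∈ S (φ t x)) (x : M) (hx : x ∈ Λ) (t : ℝ) :
    (S x).map (tangentFlow (E := E) φ t x : TangentSpace 𝓘(ℝ, E) x →ₗ[ℝ] TangentSpace 𝓘(ℝ, E) (φ t x)) =
      S (φ t x) := by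
  refine le_antisymm ?_ fun w hw => ?_
  · rintro _ ⟨v, hv, rfl⟩
    exact h x hx t v hv
  have h1 := h (φ t x) (hΛ t hx) (-t) w hw
  have h2 := hφ.tangentFlow_add (-t) t (φ t x) w
  rw [add_neg_cancel, tangentFlow_zero] at h2
  have h3 : φ (-t) (φ t x) = x := by
    rw [← φ.map_add, neg_add_cancel, φ.map_zero_apply]
  generalize tangentFlow φ (-t) (φ t x) w = v at h1 h2
  revert v
  rw [h3]
  intro v h1 h2
  refine ⟨v, h1, ?_⟩
  exact (eq_of_heq (TotalSpace.mk.inj h2).2).symm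

variable [RiemannianBundle (fun x : M => TangentSpace 𝓘(ℝ, E) x)]

section NormOn

variable {x y : M} {L : TangentSpace 𝓘(ℝ, E) x →L[ℝ] TangentSpace 𝓘(ℝ, E) y}
  {S : Submodule ℝ (TangentSpace 𝓘(ℝ, E) x)}

lemma normOn_nonneg : 0 ≤ normOn L S := norm_nonneg (L ∘L S.subtypeL)

lemma norm_le_normOn_mul {v : TangentSpace 𝓘(ℝ, E) x} (hv : v ∈ S) :
    ‖L v‖ ≤ normOn L S * ‖v‖ :=
  (L ∘L S.subtypeL).le_opNorm ⟨v, hv⟩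

/-- The factor `a` stays on the left so that it may vanish; domination needs this with `a` the norm
of `P_t` on the contracted bundle. -/
lemma mul_normOn_le {a D : ℝ} (ha : 0 ≤ a) (hD : 0 ≤ D) (h : ∀ v ∈ S, a * ‖L v‖ ≤ D * ‖v‖) :
    a * normOn L S ≤ D := by
  rcases ha.eq_or_lt with rfl | ha
  · simpa using hD
  rw [← le_div_iff₀' ha]
  refine (L ∘L S.subtypeL).opNorm_le_bound (by positivity) fun v => ?_
  rw [div_mul_eq_mul_div, le_div_iff₀' ha]
  exact h v v.2

lemma normOn_le {D : ℝ} (hD : 0 ≤ D) (h : ∀ v ∈ S, ‖L v‖ ≤ D * ‖v‖) : normOn L S ≤ D := by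
  simpa using mul_normOn_le (L := L) (S := S) zero_le_one hD (by simpa using h)

end NormOn

section Axial

variable {X : ∀ x : M, TangentSpace 𝓘(ℝ, E) x} {x : M}

lemma axialCoeff_add (v w : TangentSpace 𝓘(ℝ, E) x) :
    axialCoeff X ⟨x, v + w⟩ = axialCoeff X ⟨x, v⟩ + axialCoeff X ⟨x, w⟩ := by
  simp only [axialCoeff, inner_add_right, add_div]

lemma axialCoeff_smul (a : ℝ) (v : TangentSpace 𝓘(ℝ, E) x) :
    axialCoeff X ⟨x, a • v⟩ = a * axialCoeff X ⟨x, v⟩ := by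
  simp only [axialCoeff, real_inner_smul_right, mul_div_assoc]

lemma axialCoeff_self (h : X x ≠ 0) : axialCoeff X ⟨x, X x⟩ = 1 := by
  have : ‖X x‖ ≠ 0 := norm_ne_zero_iff.2 h
  simp only [axialCoeff, real_inner_self_eq_norm_sq]
  exact div_self (pow_ne_zero 2 this)

lemma abs_axialCoeff_le (v : TangentSpace 𝓘(ℝ, E) x) {m : ℝ} (hm : 0 < m) (h : m ≤ ‖X x‖) :
    |axialCoeff X ⟨x, v⟩| ≤ m⁻¹ * ‖v‖ := by
  have h0 : 0 < ‖X x‖ := hm.trans_le h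
  simp only [axialCoeff, abs_div, abs_pow, abs_norm]
  rw [div_le_iff₀ (by positivity)]
  refine (abs_real_inner_le_norm _ _).trans ?_
  have : 1 ≤ m⁻¹ * ‖X x‖ := by rwa [le_inv_mul_iff₀ hm, mul_one]
  calc ‖X x‖ * ‖v‖ = 1 * (‖X x‖ * ‖v‖) := (one_mul _).symm
    _ ≤ (m⁻¹ * ‖X x‖) * (‖X x‖ * ‖v‖) := by gcongr
    _ = _ := by ring

lemma eq_starProjection_add (v : TangentSpace 𝓘(ℝ, E) x) :
    v = (normalSpace X x).starProjection v + axialCoeff X ⟨x, v⟩ • X x := by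
  rw [starProjection_normalSpace, sub_add_cancel]

lemma starProjection_normalSpace_generator (c : ℝ) :
    (normalSpace X x).starProjection (c • X x) = 0 := by
  rw [Submodule.starProjection_apply_eq_zero_iff]
  exact Submodule.le_orthogonal_orthogonal _
    (Submodule.smul_mem _ _ (Submodule.mem_span_singleton_self _))

lemma norm_starProjection_le (v : TangentSpace 𝓘(ℝ, E) x) :
    ‖(normalSpace X x).starProjection v‖ ≤ ‖v‖ :=
  Submodule.norm_starProjection_apply_le _ v

lemma starProjection_of_mem {v : TangentSpace 𝓘(ℝ, E) x} (hv : v ∈ normalSpace X x) :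
    (normalSpace X x).starProjection v = v :=
  Submodule.starProjection_eq_self_iff.2 hv

lemma generator_mem_normalSpace (h : X x ∈ normalSpace X x) : X x = 0 := by
  have := starProjection_normalSpace_generator (X := X) (x := x) 1
  rwa [one_smul, starProjection_of_mem h] at this

lemma mem_of_starProjection_eq_zero {C : ∀ x : M, Submodule ℝ (TangentSpace 𝓘(ℝ, E) x)} (hXC : X x ∈ C x) {v : TangentSpace 𝓘(ℝ, E) x}
    (hv : (normalSpace X x).starProjection v = 0) : v ∈ C x := by
  rw [eq_starProjection_add (X := X) v, hv, zero_add]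
  exact Submodule.smul_mem _ _ hXC

end Axial

section Poincare

variable {φ : Flow ℝ M} {X : ∀ x : M, TangentSpace 𝓘(ℝ, E) x}

lemma linearPoincareFlow_apply (t : ℝ) (x : M) (v : TangentSpace 𝓘(ℝ, E) x) :
    linearPoincareFlow φ X t x v =
      (normalSpace X (φ t x)).starProjection (tangentFlow φ t x v) := rfl

lemma norm_linearPoincareFlow_le (t : ℝ) (x : M) (v : TangentSpace 𝓘(ℝ, E) x) :
    ‖linearPoincareFlow φ X t x v‖ ≤ ‖tangentFlow φ t x v‖ := by
  rw [linearPoincareFlow_apply]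
  exact norm_starProjection_le _

/-- The coefficient along the flow direction of the image under `DX_t`. -/
noncomputable def shear (φ : Flow ℝ M) (X : ∀ x : M, TangentSpace 𝓘(ℝ, E) x) (t : ℝ)
    (p : TangentBundle 𝓘(ℝ, E) M) : ℝ :=
  axialCoeff X ⟨φ t p.1, tangentFlow φ t p.1 p.2⟩

lemma tangentFlow_eq_add_shear (t : ℝ) (x : M) (v : TangentSpace 𝓘(ℝ, E) x) :
    tangentFlow φ t x v = linearPoincareFlow φ X t x v + shear φ X t ⟨x, v⟩ • X (φ t x) := by
  rw [linearPoincareFlow_apply]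
  exact eq_starProjection_add _

lemma shear_add_vector (t : ℝ) (x : M) (v w : TangentSpace 𝓘(ℝ, E) x) :
    shear φ X t ⟨x, v + w⟩ = shear φ X t ⟨x, v⟩ + shear φ X t ⟨x, w⟩ := by
  simp only [shear, map_add, axialCoeff_add]

lemma shear_smul (t : ℝ) (x : M) (a : ℝ) (v : TangentSpace 𝓘(ℝ, E) x) :
    shear φ X t ⟨x, a • v⟩ = a * shear φ X t ⟨x, v⟩ := by
  simp only [shear, map_smul, axialCoeff_smul]

lemma shear_generator (hφ : IsC1Flow (E := E) φ) (hX : IsGeneratedBy φ X) (t : ℝ) (x : M)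
    (h : X (φ t x) ≠ 0) (a : ℝ) : shear φ X t ⟨x, a • X x⟩ = a := by
  rw [shear_smul]
  simp only [shear, hφ.tangentFlow_generator hX, axialCoeff_self h, mul_one]

lemma shear_tangentFlow (hφ : IsC1Flow (E := E) φ) (s t : ℝ) (x : M)
    (v : TangentSpace 𝓘(ℝ, E) x) :
    shear φ X (t + s) ⟨x, v⟩ = shear φ X t ⟨φ s x, tangentFlow φ s x v⟩ :=
  congrArg (axialCoeff X) (hφ.tangentFlow_add s t x v)

/-- Apply `DX_t` to `DX_s v = P_s v + σ_s(v) X`; the last term keeps its coefficient because `X` is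
invariant. -/
lemma shear_add (hφ : IsC1Flow (E := E) φ) (hX : IsGeneratedBy φ X) (s t : ℝ) (x : M)
    (h : X (φ t (φ s x)) ≠ 0) (v : TangentSpace 𝓘(ℝ, E) x) :
    shear φ X (t + s) ⟨x, v⟩ =
      shear φ X s ⟨x, v⟩ + shear φ X t ⟨φ s x, linearPoincareFlow φ X s x v⟩ := by
  rw [shear_tangentFlow hφ, tangentFlow_eq_add_shear (X := X), shear_add_vector,
    shear_generator hφ hX _ _ h, add_comm]

lemma linearPoincareFlow_smul_generator (hφ : IsC1Flow (E := E) φ) (hX : IsGeneratedBy φ X) (t : ℝ)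
    (x : M) (a : ℝ) : linearPoincareFlow φ X t x (a • X x) = 0 := by
  rw [linearPoincareFlow_apply, map_smul, hφ.tangentFlow_generator hX,
    starProjection_normalSpace_generator]

/-- `P_t` kills the flow direction, hence is the map induced by `DX_t` on the quotient by `⟨X⟩`; its
cocycle law follows. -/
lemma linearPoincareFlow_starProjection (hφ : IsC1Flow (E := E) φ) (hX : IsGeneratedBy φ X) (t : ℝ)
    (x : M) (v : TangentSpace 𝓘(ℝ, E) x) :
    linearPoincareFlow φ X t x ((normalSpace X x).starProjection v) =
      linearPoincareFlow φ X t x v := by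
  conv_rhs => rw [eq_starProjection_add (X := X) v]
  rw [map_add, linearPoincareFlow_smul_generator hφ hX, add_zero]

lemma linearPoincareFlow_add (hφ : IsC1Flow (E := E) φ) (hX : IsGeneratedBy φ X) (s t : ℝ)
    (x : M) (v : TangentSpace 𝓘(ℝ, E) x) :
    (⟨φ (t + s) x, linearPoincareFlow φ X (t + s) x v⟩ : TangentBundle 𝓘(ℝ, E) M) =
      ⟨φ t (φ s x), linearPoincareFlow φ X t (φ s x) (linearPoincareFlow φ X s x v)⟩ := by
  rw [linearPoincareFlow_apply s, linearPoincareFlow_starProjection hφ hX]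
  exact congrArg (fun p : TangentBundle 𝓘(ℝ, E) M =>
    (⟨p.1, (normalSpace X p.1).starProjection p.2⟩ : TangentBundle 𝓘(ℝ, E) M))
    (hφ.tangentFlow_add s t x v)

lemma norm_linearPoincareFlow_add (hφ : IsC1Flow (E := E) φ) (hX : IsGeneratedBy φ X) (s t : ℝ)
    (x : M) (v : TangentSpace 𝓘(ℝ, E) x) :
    ‖linearPoincareFlow φ X (t + s) x v‖ =
      ‖linearPoincareFlow φ X t (φ s x) (linearPoincareFlow φ X s x v)‖ :=
  congrArg (fun p : TangentBundle 𝓘(ℝ, E) M => ‖p.2‖) (linearPoincareFlow_add hφ hX s t x v)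

end Poincare

end

/-! ### Position of the generator and projection of subbundles. -/

section

variable {E : Type*} [NormedAddCommGroup E] [NormedSpace ℝ E]
  {M : Type*} [TopologicalSpace M] [ChartedSpace E M]

variable [IsManifold 𝓘(ℝ, E) 1 M] [RiemannianBundle (fun x : M => TangentSpace 𝓘(ℝ, E) x)]
  [IsContinuousRiemannianBundle E (fun x : M => TangentSpace 𝓘(ℝ, E) x)]
  {φ : Flow ℝ M} {X : ∀ x : M, TangentSpace 𝓘(ℝ, E) x} {Λ : Set M}
  {S C : ∀ x : M, Submodule ℝ (TangentSpace 𝓘(ℝ, E) x)}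

lemma continuousOn_starProjection
    (hX : Continuous (fun x : M => (⟨x, X x⟩ : TangentBundle 𝓘(ℝ, E) M))) {s : Set M}
    (h0 : ∀ x ∈ s, X x ≠ 0) {v : ∀ x : M, TangentSpace 𝓘(ℝ, E) x}
    (hv : ContinuousOn (fun x : M => (⟨x, v x⟩ : TangentBundle 𝓘(ℝ, E) M)) s) :
    ContinuousOn (fun x : M =>
      (⟨x, (normalSpace X x).starProjection (v x)⟩ : TangentBundle 𝓘(ℝ, E) M)) s := by
  have h1 := (continuousOn_axialCoeff (f := fun x : M => x) hX h0 hv).neg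
  refine (continuousOn_section_add hv (continuousOn_section_smul h1 hX.continuousOn)).congr ?_
  intro x _
  simp only [starProjection_normalSpace, Pi.neg_apply, neg_smul, sub_eq_add_neg]

/-- The generator of the flow lies in the central subbundle. -/
lemma IsPartiallyHyperbolicSplitting.generator_mem
    (h : IsPartiallyHyperbolicSplitting φ (tangentFlow φ) Λ (fun _ => ⊤) S C)
    (hφ : IsC1Flow (E := E) φ) (hX : IsGeneratedBy φ X) (hcomp : IsCompact Λ)
    (hinv : IsInvariant φ Λ) (hns : ∀ x ∈ Λ, X x ≠ 0) (x : M) (hx : x ∈ Λ) : X x ∈ C x := by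
  obtain ⟨c, hc, hc'⟩ := exists_norm_le_norm_add hcomp h.splitting.continuous_left
    h.splitting.continuous_right h.splitting.disjoint
  obtain ⟨m, hm, D, hD, hmD⟩ := exists_norm_bounds (hφ.continuous_generator hX) hcomp hns
  obtain ⟨K, hK, l, hl, hKl⟩ := h.contracted
  -- By uniqueness of the decomposition, the `S`-component of `X z` is the image of that of `X y`,
  -- whose norm is at most `c * D`. Below, `y = X_{-t}(x)` with `t → ∞`.
  have key (t : ℝ) (ht : 0 ≤ t) (y : M) (hy : y ∈ Λ) (z : M) (hz : φ t y = z) :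
      ∀ v ∈ S z, ∀ w ∈ C z, v + w = X z → ‖v‖ ≤ K * Real.exp (-l * t) * (c * D) := by
    subst hz
    intro v hv w hw hvw
    obtain ⟨v', hv', w', hw', hvw'⟩ := Submodule.mem_sup.1
      ((h.splitting.sup_eq y hy).symm ▸ Submodule.mem_top : X y ∈ S y ⊔ C y)
    have h1 : tangentFlow φ t y v' ∈ S (φ t y) := by
      rw [← h.splitting.invariant_left y hy t]
      exact Submodule.mem_map_of_mem hv'
    have h2 : tangentFlow φ t y w' ∈ C (φ t y) := by
      rw [← h.splitting.invariant_right y hy t]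
      exact Submodule.mem_map_of_mem hw'
    have h3 : tangentFlow φ t y v' + tangentFlow φ t y w' = X (φ t y) := by
      rw [← map_add, hvw', hφ.tangentFlow_generator hX]
    have h4 : v - tangentFlow φ t y v' = tangentFlow φ t y w' - w := by
      rw [sub_eq_sub_iff_add_eq_add, hvw, add_comm, h3]
    have h5 : v - tangentFlow φ t y v' = 0 :=
      Submodule.disjoint_def.1 (h.splitting.disjoint _ (hinv t hy)) _ (Submodule.sub_mem _ hv h1)
        (h4 ▸ Submodule.sub_mem _ h2 hw)
    rw [sub_eq_zero.1 h5]
    have h6 : ‖v'‖ ≤ c * D := by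
      refine (hc' y hy v' hv' w' hw').trans ?_
      rw [hvw']
      exact mul_le_mul_of_nonneg_left (hmD y hy).2 hc.le
    exact (norm_le_normOn_mul hv').trans (mul_le_mul (hKl y hy t ht) h6 (norm_nonneg _)
      (by positivity))
  obtain ⟨v, hv, w, hw, hvw⟩ := Submodule.mem_sup.1
    ((h.splitting.sup_eq x hx).symm ▸ Submodule.mem_top : X x ∈ S x ⊔ C x)
  have h1 : ∀ᶠ t : ℝ in atTop, ‖v‖ ≤ K * Real.exp (-l * t) * (c * D) := by
    filter_upwards [eventually_ge_atTop 0] with t ht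
    refine key t ht (φ (-t) x) (hinv _ hx) x ?_ v hv w hw hvw
    rw [← φ.map_add, add_neg_cancel, φ.map_zero_apply]
  have h2 : Tendsto (fun t : ℝ => K * Real.exp (-l * t) * (c * D)) atTop (𝓝 0) := by
    have : Tendsto (fun t : ℝ => -l * t) atTop atBot :=
      tendsto_id.const_mul_atTop_of_neg (neg_lt_zero.2 hl)
    simpa using ((Real.tendsto_exp_atBot.comp this).const_mul K).mul_const (c * D)
  have h3 : v = 0 := norm_le_zero_iff.1 (ge_of_tendsto h2 h1)
  rw [← hvw, h3, zero_add]
  exact hw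

/-- A subbundle transverse to the flow direction projects to a subbundle of the normal bundle. -/
lemma IsContinuousSubbundle.map_starProjection (hS : IsContinuousSubbundle Λ S)
    (hX : Continuous (fun x : M => (⟨x, X x⟩ : TangentBundle 𝓘(ℝ, E) M)))
    (hns : ∀ x ∈ Λ, X x ≠ 0)
    (h : ∀ x ∈ Λ, ∀ v ∈ S x, (normalSpace X x).starProjection v = 0 → v = 0) :
    IsContinuousSubbundle Λ fun x => (S x).map
      ((normalSpace X x).starProjection : TangentSpace 𝓘(ℝ, E) x →ₗ[ℝ] TangentSpace 𝓘(ℝ, E) x) := by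
  intro x hx
  obtain ⟨U, hU, k, u, hu, hspan⟩ := hS x hx
  refine ⟨U, hU, k, fun i y => (normalSpace X y).starProjection (u i y), fun i => ?_,
    fun y hy => ⟨?_, ?_⟩⟩
  · exact continuousOn_starProjection hX (fun z hz => hns z hz.2) (hu i)
  · refine (hspan y hy).1.map (f := ((normalSpace X y).starProjection :
      TangentSpace 𝓘(ℝ, E) y →ₗ[ℝ] TangentSpace 𝓘(ℝ, E) y)) ?_
    rw [(hspan y hy).2, Submodule.disjoint_def]
    intro v hv hv0
    exact h y hy.2 v hv (LinearMap.mem_ker.1 hv0)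
  · simp only [← (hspan y hy).2, Submodule.map_span, ← range_comp]
    rfl

/-- Steinitz exchange: `v` replaces a frame vector on which it has a nonzero coefficient. -/
lemma exists_linearIndependent_cons {V : Type*} [AddCommGroup V] [Module ℝ V] {k : ℕ}
    {u : Fin (k + 1) → V} (hu : LinearIndependent ℝ u) {v : V} (hv : v ∈ Submodule.span ℝ (range u))
    (hv0 : v ≠ 0) : ∃ j : Fin (k + 1), LinearIndependent ℝ (Fin.cons v (u ∘ j.succAbove) : Fin (k + 1) → V) := by
  obtain ⟨a, rfl⟩ := (Submodule.mem_span_range_iff_exists_fun ℝ).1 hv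
  obtain ⟨j, hj⟩ : ∃ j, a j ≠ 0 := by
    by_contra! h
    exact hv0 (by simp [h])
  refine ⟨j, linearIndependent_finCons.2 ⟨hu.comp _ Fin.succAbove_right_injective, fun hmem => ?_⟩⟩
  obtain ⟨d, hd⟩ := (Submodule.mem_span_range_iff_exists_fun ℝ).1 hmem
  have h1 : ∑ i, (a i - j.insertNth (α := fun _ => ℝ) 0 d i) • u i = 0 := by
    simp only [sub_smul, Finset.sum_sub_distrib]
    rw [← hd, Fin.sum_univ_succAbove _ j, sub_eq_zero]
    simp
  have h2 := Fintype.linearIndependent_iff.1 hu _ h1 j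
  simp at h2
  exact hj h2

/-- A subbundle which contains the flow direction projects to a subbundle of the normal bundle. -/
lemma IsContinuousSubbundle.map_starProjection_of_mem (hC : IsContinuousSubbundle Λ C)
    (hX : Continuous (fun x : M => (⟨x, X x⟩ : TangentBundle 𝓘(ℝ, E) M)))
    (hns : ∀ x ∈ Λ, X x ≠ 0) (hXC : ∀ x ∈ Λ, X x ∈ C x) :
    IsContinuousSubbundle Λ fun x => (C x).map
      ((normalSpace X x).starProjection : TangentSpace 𝓘(ℝ, E) x →ₗ[ℝ] TangentSpace 𝓘(ℝ, E) x) := by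
  intro x hx
  obtain ⟨U, hU, k, u, hu, hspan⟩ := hC x hx
  have hxU : x ∈ U ∩ Λ := ⟨mem_of_mem_nhds hU, hx⟩
  have hXx : X x ∈ Submodule.span ℝ (range fun i => u i x) := (hspan x hxU).2 ▸ hXC x hx
  rcases k with _ | k
  · rw [range_eq_empty, Submodule.span_empty] at hXx
    exact absurd ((Submodule.mem_bot ℝ).1 hXx) (hns x hx)
  obtain ⟨j, hj⟩ := exists_linearIndependent_cons (hspan x hxU).1 hXx (hns x hx)
  let w : Fin (k + 1) → ∀ y : M, TangentSpace 𝓘(ℝ, E) y := Fin.cons X (u ∘ j.succAbove)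
  have hwy (y : M) : (fun i => w i y) =
      (Fin.cons (X y) ((fun i => u i y) ∘ j.succAbove) : Fin (k + 1) → TangentSpace 𝓘(ℝ, E) y) := by
    ext i
    refine Fin.cases ?_ (fun i => ?_) i <;> rfl
  have hw (i : Fin (k + 1)) :
      ContinuousOn (fun y : M => (⟨y, w i y⟩ : TangentBundle 𝓘(ℝ, E) M)) (U ∩ Λ) := by
    refine Fin.cases ?_ (fun i => ?_) i
    · exact hX.continuousOn
    · exact hu _
  -- The exchange index `j` is chosen at `x` only; the uniform estimate keeps the exchanged frame
  -- independent at nearby points.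
  obtain ⟨c, hc, hc'⟩ := eventually_norm_le_of_linearIndependent hx hU hw (by rw [hwy]; exact hj)
  obtain ⟨U', hU', hU''⟩ := mem_nhdsWithin_iff_exists_mem_nhds_inter.1 hc'
  refine ⟨U ∩ U', inter_mem hU hU', k,
    fun i y => (normalSpace X y).starProjection (u (j.succAbove i) y), fun i => ?_, fun y hy => ?_⟩
  · exact (continuousOn_starProjection hX (fun z hz => hns z hz.2) (hu _)).mono
      fun y hy => ⟨hy.1.1, hy.2⟩
  have hyU : y ∈ U ∩ Λ := ⟨hy.1.1, hy.2⟩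
  have hli : LinearIndependent ℝ fun i => w i y := by
    rw [Fintype.linearIndependent_iff]
    intro a ha i
    have := hU'' ⟨hy.1.2, hy.2⟩ a
    rw [ha, norm_zero, mul_zero] at this
    rw [norm_le_zero_iff.1 this]
    rfl
  have hspanw : Submodule.span ℝ (range fun i => w i y) = C y := by
    have hle : Submodule.span ℝ (range fun i => w i y) ≤ C y := by
      rw [Submodule.span_le]
      rintro _ ⟨i, rfl⟩
      refine Fin.cases ?_ (fun i => ?_) i
      · exact hXC y hy.2
      · rw [SetLike.mem_coe, ← (hspan y hyU).2]
        exact Submodule.subset_span ⟨_, rfl⟩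
    have hfin : Module.Finite ℝ (C y) := by
      rw [← (hspan y hyU).2]
      exact Module.Finite.span_of_finite ℝ (finite_range _)
    refine Submodule.eq_of_le_of_finrank_eq hle ?_
    rw [← (hspan y hyU).2, finrank_span_eq_card hli, finrank_span_eq_card (hspan y hyU).1]
  rw [hwy] at hli hspanw
  obtain ⟨hli', hXn⟩ := linearIndependent_finCons.1 hli
  constructor
  -- The kernel of the projection is `⟨X y⟩`, which meets the span of the other frame vectors only
  -- in zero.
  · refine hli'.map (f := ((normalSpace X y).starProjection :
      TangentSpace 𝓘(ℝ, E) y →ₗ[ℝ] TangentSpace 𝓘(ℝ, E) y)) ?_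
    rw [Submodule.disjoint_def]
    intro v hv hv0
    have h1 := eq_starProjection_add (X := X) v
    have h2 : (normalSpace X y).starProjection v = 0 := LinearMap.mem_ker.1 hv0
    rw [h2, zero_add] at h1
    by_cases ha : axialCoeff X ⟨y, v⟩ = 0
    · rw [h1, ha, zero_smul]
    · refine absurd ?_ hXn
      have h3 : X y = (axialCoeff X ⟨y, v⟩)⁻¹ • v := by
        conv_rhs => rw [h1]
        rw [axialCoeff_smul, axialCoeff_self (hns y hy.2), mul_one, inv_smul_smul₀ ha]
      rw [h3]
      exact Submodule.smul_mem _ _ hv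
  · simp only [← hspanw, Submodule.map_span, ← range_comp]
    apply le_antisymm
    · apply Submodule.span_mono
      rintro _ ⟨i, rfl⟩
      exact ⟨i.succ, rfl⟩
    · rw [Submodule.span_le]
      rintro _ ⟨i, rfl⟩
      refine Fin.cases ?_ (fun i => ?_) i
      · have := starProjection_normalSpace_generator (X := X) (x := y) 1
        rw [one_smul] at this
        have h0 : (0 : TangentSpace 𝓘(ℝ, E) y) ∈ Submodule.span ℝ (range fun i =>
          (normalSpace X y).starProjection (u (j.succAbove i) y)) := Submodule.zero_mem _
        rw [← this] at h0
        exact h0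
      · exact Submodule.subset_span ⟨i, rfl⟩

end

/-! ### From a splitting for the derivative to one for the Poincaré flow. -/

section

variable {E : Type*} [NormedAddCommGroup E] [NormedSpace ℝ E]
  {M : Type*} [TopologicalSpace M] [ChartedSpace E M]

variable [RiemannianBundle (fun x : M => TangentSpace 𝓘(ℝ, E) x)]
  {φ : Flow ℝ M} {X : ∀ x : M, TangentSpace 𝓘(ℝ, E) x} {Λ : Set M}
  {S C : ∀ x : M, Submodule ℝ (TangentSpace 𝓘(ℝ, E) x)}

/-- The projection of a family of subspaces to the normal bundle. -/
noncomputable def normalPart (X : ∀ x : M, TangentSpace 𝓘(ℝ, E) x)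
    (S : ∀ x : M, Submodule ℝ (TangentSpace 𝓘(ℝ, E) x)) (x : M) :
    Submodule ℝ (TangentSpace 𝓘(ℝ, E) x) :=
  (S x).map
    ((normalSpace X x).starProjection : TangentSpace 𝓘(ℝ, E) x →ₗ[ℝ] TangentSpace 𝓘(ℝ, E) x)

lemma map_linearPoincareFlow_normalPart (hφ : IsC1Flow (E := E) φ) (hX : IsGeneratedBy φ X)
    {x : M} {t : ℝ} (h : (S x).map (tangentFlow (E := E) φ t x :
      TangentSpace 𝓘(ℝ, E) x →ₗ[ℝ] TangentSpace 𝓘(ℝ, E) (φ t x)) = S (φ t x)) :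
    (normalPart X S x).map (linearPoincareFlow φ X t x :
      TangentSpace 𝓘(ℝ, E) x →ₗ[ℝ] TangentSpace 𝓘(ℝ, E) (φ t x)) = normalPart X S (φ t x) := by
  simp only [normalPart, ← h, ← Submodule.map_comp]
  congr 1
  ext v
  exact linearPoincareFlow_starProjection hφ hX t x v

/-- The projection kills only a line, so it cannot kill a space of dimension at least two. -/
lemma normalPart_ne_bot {x : M} (h : 2 ≤ Module.finrank ℝ (C x)) : normalPart X C x ≠ ⊥ := by
  intro hbot
  have hle : C x ≤ Submodule.span ℝ {X x} := by
    intro v hv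
    have hv0 : (normalSpace X x).starProjection v = 0 :=
      (Submodule.eq_bot_iff _).1 hbot _ (Submodule.mem_map_of_mem hv)
    rw [eq_starProjection_add (X := X) v, hv0, zero_add]
    exact Submodule.smul_mem _ _ (Submodule.mem_span_singleton_self _)
  have h1 := Submodule.finrank_mono hle
  have h2 := finrank_span_le_card (R := ℝ) ({X x} : Set (TangentSpace 𝓘(ℝ, E) x))
  simp at h2
  omega

variable [IsManifold 𝓘(ℝ, E) 1 M]
  [IsContinuousRiemannianBundle E (fun x : M => TangentSpace 𝓘(ℝ, E) x)]

theorem IsPartiallyHyperbolicSplitting.normalPart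
    (h : IsPartiallyHyperbolicSplitting φ (tangentFlow φ) Λ (fun _ => ⊤) S C)
    (hφ : IsC1Flow (E := E) φ) (hX : IsGeneratedBy φ X) (hcomp : IsCompact Λ)
    (hinv : IsInvariant φ Λ) (hns : ∀ x ∈ Λ, X x ≠ 0) :
    IsPoincarePHSplitting φ X Λ (normalPart X S) (normalPart X C) := by
  have hXC := h.generator_mem hφ hX hcomp hinv hns
  have hXc := hφ.continuous_generator hX
  have hinj : ∀ x ∈ Λ, ∀ v ∈ S x, (normalSpace X x).starProjection v = 0 → v = 0 :=
    fun x hx v hv hv0 => Submodule.disjoint_def.1 (h.splitting.disjoint x hx) v hv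
      (mem_of_starProjection_eq_zero (hXC x hx) hv0)
  obtain ⟨c, hc, hc'⟩ := exists_norm_le_norm_add hcomp h.splitting.continuous_left
    h.splitting.continuous_right h.splitting.disjoint
  -- `Πv` differs from `v` by a multiple of `X`, which lies in `C`; so `v` is the `S`-component of
  -- `Πv`.
  have hbound : ∀ x ∈ Λ, ∀ v ∈ S x, ‖v‖ ≤ c * ‖(normalSpace X x).starProjection v‖ := by
    intro x hx v hv
    rw [starProjection_normalSpace, sub_eq_add_neg, ← neg_smul]
    exact hc' x hx v hv _ (Submodule.smul_mem _ _ (hXC x hx))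
  have hS : ∀ x ∈ Λ, ∀ t : ℝ, normOn (linearPoincareFlow φ X t x) (FlowSplitting.normalPart X S x) ≤
      c * normOn (tangentFlow φ t x) (S x) := by
    intro x hx t
    refine normOn_le (mul_nonneg hc.le normOn_nonneg) ?_
    rintro _ ⟨v, hv, rfl⟩
    have h1 : linearPoincareFlow φ X t x ((normalSpace X x).starProjection v) =
      linearPoincareFlow φ X t x v := linearPoincareFlow_starProjection hφ hX t x v
    refine (congrArg norm h1).le.trans ?_
    refine (norm_linearPoincareFlow_le t x v).trans ((norm_le_normOn_mul hv).trans ?_)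
    refine (mul_le_mul_of_nonneg_left (hbound x hx v hv) normOn_nonneg).trans (le_of_eq ?_)
    rw [ContinuousLinearMap.coe_coe]
    ring
  -- No constant is lost here: `ΠC ⊆ C` because `X` lies in `C`, and `Π` does not increase norms.
  have hC : ∀ x ∈ Λ, ∀ t : ℝ, normOn (linearPoincareFlow φ X t x) (FlowSplitting.normalPart X C x) ≤
      normOn (tangentFlow φ t x) (C x) := by
    intro x hx t
    refine normOn_le normOn_nonneg ?_
    rintro _ ⟨v, hv, rfl⟩
    refine (norm_linearPoincareFlow_le t x _).trans (norm_le_normOn_mul ?_)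
    rw [ContinuousLinearMap.coe_coe, starProjection_normalSpace]
    exact Submodule.sub_mem _ hv (Submodule.smul_mem _ _ (hXC x hx))
  refine ⟨⟨?_, ?_, ?_, ?_, ?_, ?_⟩, ?_, ?_, ?_⟩
  · intro x hx
    rw [FlowSplitting.normalPart, FlowSplitting.normalPart, ← Submodule.map_sup,
      h.splitting.sup_eq x hx, Submodule.map_top]
    exact Submodule.range_starProjection _
  · intro x hx
    rw [Submodule.disjoint_def]
    rintro _ ⟨v, hv, rfl⟩ ⟨w, hw, hwv⟩
    have h1 : (normalSpace X x).starProjection (v - w) = 0 := by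
      rw [map_sub, sub_eq_zero]
      exact hwv.symm
    have h2 : v ∈ C x := by
      have := Submodule.add_mem _ (mem_of_starProjection_eq_zero (hXC x hx) h1) hw
      rwa [sub_add_cancel] at this
    rw [Submodule.disjoint_def.1 (h.splitting.disjoint x hx) v hv h2, map_zero]
  · exact h.splitting.continuous_left.map_starProjection hXc hns hinj
  · exact h.splitting.continuous_right.map_starProjection_of_mem hXc hns hXC
  · exact fun x hx t => map_linearPoincareFlow_normalPart hφ hX (h.splitting.invariant_left x hx t)
  · exact fun x hx t => map_linearPoincareFlow_normalPart hφ hX (h.splitting.invariant_right x hx t)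
  · obtain ⟨K, hK, l, hl, hKl⟩ := h.dominated
    refine ⟨c * K, by positivity, l, hl, fun x hx t ht => ?_⟩
    calc _ ≤ (c * normOn (tangentFlow φ t x) (S x)) *
          normOn (tangentFlow φ (-t) (φ t x)) (C (φ t x)) :=
          mul_le_mul (hS x hx t) (hC _ (hinv t hx) (-t)) normOn_nonneg
            (mul_nonneg hc.le normOn_nonneg)
      _ = c * (normOn (tangentFlow φ t x) (S x) *
          normOn (tangentFlow φ (-t) (φ t x)) (C (φ t x))) := mul_assoc _ _ _
      _ < c * (K * Real.exp (-l * t)) := mul_lt_mul_of_pos_left (hKl x hx t ht) hc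
      _ = _ := (mul_assoc _ _ _).symm
  · obtain ⟨K, hK, l, hl, hKl⟩ := h.contracted
    refine ⟨c * K, by positivity, l, hl, fun x hx t ht => (hS x hx t).trans ?_⟩
    rw [mul_assoc]
    exact mul_le_mul_of_nonneg_left (hKl x hx t ht) hc.le
  · intro x hx hbot
    refine h.left_ne_bot x hx ((Submodule.eq_bot_iff _).2 fun v hv => hinj x hx v hv ?_)
    exact (Submodule.eq_bot_iff _).1 hbot _ (Submodule.mem_map_of_mem hv)

end

/-! ### Exponential estimates for the shear. -/

section

variable {E : Type*} [NormedAddCommGroup E] [NormedSpace ℝ E]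
  {M : Type*} [TopologicalSpace M] [ChartedSpace E M]

lemma exists_pos_mul_exp_le_half (K : ℝ) {l : ℝ} (hl : 0 < l) :
    ∃ τ > (0 : ℝ), K * Real.exp (-l * τ) ≤ 1 / 2 := by
  have h1 : Tendsto (fun t : ℝ => K * Real.exp (-l * t)) atTop (𝓝 0) := by
    have : Tendsto (fun t : ℝ => -l * t) atTop atBot :=
      tendsto_id.const_mul_atTop_of_neg (neg_lt_zero.2 hl)
    simpa using (Real.tendsto_exp_atBot.comp this).const_mul K
  obtain ⟨τ, h2, h3⟩ :=
    ((h1.eventually (eventually_le_nhds (by norm_num : (0 : ℝ) < 1 / 2))).and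
      (eventually_gt_atTop 0)).exists
  exact ⟨τ, h3, h2⟩

/-- Induction in steps of length `τ`. -/
lemma forall_nonneg_of_step {p : ℝ → Prop} {τ : ℝ} (hτ : 0 < τ) (h0 : ∀ t, 0 ≤ t → t ≤ τ → p t)
    (h1 : ∀ t, 0 ≤ t → p t → p (t + τ)) (t : ℝ) (ht : 0 ≤ t) : p t := by
  obtain ⟨n, hn⟩ := exists_nat_ge (t / τ)
  rw [div_le_iff₀ hτ] at hn
  induction n generalizing t with
  | zero => exact h0 t ht (by simp at hn; linarith)
  | succ n ih =>
    rcases le_or_gt t τ with h | h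
    · exact h0 t ht h
    · have := h1 (t - τ) (by linarith) (ih (t - τ) (by linarith) (by push_cast at hn; linarith))
      rwa [sub_add_cancel] at this

variable [IsManifold 𝓘(ℝ, E) 1 M] {φ : Flow ℝ M} {X : ∀ x : M, TangentSpace 𝓘(ℝ, E) x} {Λ : Set M}
  {S C : ∀ x : M, Submodule ℝ (TangentSpace 𝓘(ℝ, E) x)}

section Splitting

variable {A : ∀ (t : ℝ) (x : M), TangentSpace 𝓘(ℝ, E) x →L[ℝ] TangentSpace 𝓘(ℝ, E) (φ t x)}
  {V : ∀ x : M, Submodule ℝ (TangentSpace 𝓘(ℝ, E) x)}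

lemma IsInvariantSplitting.apply_mem_left (h : IsInvariantSplitting φ A Λ V S C) {x : M}
    (hx : x ∈ Λ) (t : ℝ) {v : TangentSpace 𝓘(ℝ, E) x} (hv : v ∈ S x) : A t x v ∈ S (φ t x) := by
  rw [← h.invariant_left x hx t]
  exact Submodule.mem_map_of_mem hv

lemma IsInvariantSplitting.apply_mem_right (h : IsInvariantSplitting φ A Λ V S C) {x : M}
    (hx : x ∈ Λ) (t : ℝ) {v : TangentSpace 𝓘(ℝ, E) x} (hv : v ∈ C x) : A t x v ∈ C (φ t x) := by
  rw [← h.invariant_right x hx t]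
  exact Submodule.mem_map_of_mem hv

lemma IsInvariantSplitting.left_le (h : IsInvariantSplitting φ A Λ V S C) {x : M} (hx : x ∈ Λ) :
    S x ≤ V x := h.sup_eq x hx ▸ le_sup_left

lemma IsInvariantSplitting.right_le (h : IsInvariantSplitting φ A Λ V S C) {x : M} (hx : x ∈ Λ) :
    C x ≤ V x := h.sup_eq x hx ▸ le_sup_right

variable [RiemannianBundle (fun x : M => TangentSpace 𝓘(ℝ, E) x)]

/-- The contraction and the domination hold with common constants. -/
lemma IsPartiallyHyperbolicSplitting.exists_rate
    (h : IsPartiallyHyperbolicSplitting φ A Λ V S C) :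
    ∃ K > (0 : ℝ), ∃ l > (0 : ℝ), (∀ x ∈ Λ, ∀ t : ℝ, 0 ≤ t →
      normOn (A t x) (S x) ≤ K * Real.exp (-l * t)) ∧ ∀ x ∈ Λ, ∀ t : ℝ, 0 < t →
      normOn (A t x) (S x) * normOn (A (-t) (φ t x)) (C (φ t x)) ≤ K * Real.exp (-l * t) := by
  obtain ⟨K, hK, l, hl, hKl⟩ := h.dominated
  obtain ⟨K', hK', l', hl', hKl'⟩ := h.contracted
  have hmono {t : ℝ} (ht : 0 ≤ t) {r : ℝ} (hr : min l l' ≤ r) :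
      Real.exp (-r * t) ≤ Real.exp (-(min l l') * t) :=
    Real.exp_le_exp.2 (mul_le_mul_of_nonneg_right (neg_le_neg hr) ht)
  refine ⟨max K K', lt_max_of_lt_left hK, min l l', lt_min hl hl', fun x hx t ht => ?_,
    fun x hx t ht => ?_⟩
  · exact (hKl' x hx t ht).trans (mul_le_mul (le_max_right _ _) (hmono ht (min_le_right _ _))
      (Real.exp_pos _).le (hK.le.trans (le_max_left _ _)))
  · exact (hKl x hx t ht).le.trans (mul_le_mul (le_max_left _ _) (hmono ht.le (min_le_left _ _))
      (Real.exp_pos _).le (hK.le.trans (le_max_left _ _)))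

end Splitting

variable [RiemannianBundle (fun x : M => TangentSpace 𝓘(ℝ, E) x)]

/-- The intermediate point is a variable `y`, so that an identity between base points can be
supplied without transporting vectors. -/
lemma IsInvariantSplitting.normOn_linearPoincareFlow_add_le
    (h : IsInvariantSplitting φ (linearPoincareFlow φ X) Λ (normalSpace X) S C)
    (hφ : IsC1Flow (E := E) φ) (hX : IsGeneratedBy φ X) {x : M} (hx : x ∈ Λ) (s t : ℝ)
    {y : M} (hy : φ s x = y) :
    normOn (linearPoincareFlow φ X (t + s) x) (S x) ≤
      normOn (linearPoincareFlow φ X t y) (S y) * normOn (linearPoincareFlow φ X s x) (S x) := by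
  subst hy
  refine normOn_le (mul_nonneg normOn_nonneg normOn_nonneg) fun v hv => ?_
  rw [norm_linearPoincareFlow_add hφ hX, mul_assoc]
  exact (norm_le_normOn_mul (h.apply_mem_left hx s hv)).trans
    (mul_le_mul_of_nonneg_left (norm_le_normOn_mul hv) normOn_nonneg)

variable [IsContinuousRiemannianBundle E (fun x : M => TangentSpace 𝓘(ℝ, E) x)]

lemma IsContinuousSubbundle.exists_shear_bound (hS : IsContinuousSubbundle Λ S)
    (hφ : IsC1Flow (E := E) φ) (hX : IsGeneratedBy φ X) (hcomp : IsCompact Λ)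
    (hinv : IsInvariant φ Λ) (hns : ∀ x ∈ Λ, X x ≠ 0) (T : ℝ) :
    ∃ B > (0 : ℝ), ∀ t ∈ Icc (-T) T, ∀ x ∈ Λ, ∀ v ∈ S x, |shear φ X t ⟨x, v⟩| ≤ B * ‖v‖ := by
  obtain ⟨m, hm, D, hD, hmD⟩ := exists_norm_bounds (hφ.continuous_generator hX) hcomp hns
  obtain ⟨B, hB, hB'⟩ := hS.exists_tangentFlow_bound hφ hcomp T
  refine ⟨m⁻¹ * B, by positivity, fun t ht x hx v hv => ?_⟩
  refine (abs_axialCoeff_le _ hm (hmD _ (hinv t hx)).1).trans ?_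
  rw [mul_assoc]
  exact mul_le_mul_of_nonneg_left (hB' t ht x hx v hv) (by positivity)

/-- The shear of a contracted subbundle is bounded in forward time. -/
lemma IsPoincarePHSplitting.exists_shear_bound_left
    (h : IsPoincarePHSplitting φ X Λ S C)
    (hφ : IsC1Flow (E := E) φ) (hX : IsGeneratedBy φ X) (hcomp : IsCompact Λ)
    (hinv : IsInvariant φ Λ) (hns : ∀ x ∈ Λ, X x ≠ 0) :
    ∃ B > (0 : ℝ), ∀ t : ℝ, 0 ≤ t → ∀ x ∈ Λ, ∀ v ∈ S x, |shear φ X t ⟨x, v⟩| ≤ B * ‖v‖ := by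
  obtain ⟨K, hK, l, hl, hKl⟩ := h.contracted
  obtain ⟨τ, hτ, hKτ⟩ := exists_pos_mul_exp_le_half K hl
  obtain ⟨B, hB, hB'⟩ := h.splitting.continuous_left.exists_shear_bound hφ hX hcomp hinv hns τ
  -- `2 * B` reproduces itself under a step of length `τ`: `B + 2 * B * (1 / 2) = 2 * B`.
  refine ⟨2 * B, by positivity, forall_nonneg_of_step hτ ?_ ?_⟩
  · intro t ht htτ x hx v hv
    refine (hB' t ⟨by linarith, htτ⟩ x hx v hv).trans ?_
    have : 0 ≤ B * ‖v‖ := by positivity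
    linarith
  · intro t ht ih x hx v hv
    rw [shear_add hφ hX _ _ _ (hns _ (hinv _ (hinv _ hx)))]
    have h1 := hB' τ ⟨by linarith, le_rfl⟩ x hx v hv
    have h2 := ih _ (hinv τ hx) _ (h.splitting.apply_mem_left hx τ hv)
    have h3 : ‖linearPoincareFlow φ X τ x v‖ ≤ 1 / 2 * ‖v‖ :=
      (norm_le_normOn_mul hv).trans
        (mul_le_mul_of_nonneg_right ((hKl x hx τ hτ.le).trans hKτ) (norm_nonneg _))
    have h4 : 2 * B * ‖linearPoincareFlow φ X τ x v‖ ≤ 2 * B * (1 / 2 * ‖v‖) :=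
      mul_le_mul_of_nonneg_left h3 (by positivity)
    have h5 := abs_add_le (shear φ X τ ⟨x, v⟩)
      (shear φ X t ⟨φ τ x, linearPoincareFlow φ X τ x v⟩)
    linarith

/-- The backward shear of the dominating subbundle, weighted with the contraction of the dominated
one, decays exponentially. -/
lemma IsPoincarePHSplitting.exists_shear_bound_right
    (h : IsPoincarePHSplitting φ X Λ S C)
    (hφ : IsC1Flow (E := E) φ) (hX : IsGeneratedBy φ X) (hcomp : IsCompact Λ)
    (hinv : IsInvariant φ Λ) (hns : ∀ x ∈ Λ, X x ≠ 0) {K l : ℝ} (hK : 0 < K) (hl : 0 < l)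
    (hcon : ∀ x ∈ Λ, ∀ t : ℝ, 0 ≤ t →
      normOn (linearPoincareFlow φ X t x) (S x) ≤ K * Real.exp (-l * t))
    (hdom : ∀ x ∈ Λ, ∀ t : ℝ, 0 < t → normOn (linearPoincareFlow φ X t x) (S x) *
      normOn (linearPoincareFlow φ X (-t) (φ t x)) (C (φ t x)) ≤ K * Real.exp (-l * t)) :
    ∃ G > (0 : ℝ), ∀ t : ℝ, 0 ≤ t → ∀ y ∈ Λ, ∀ v ∈ C y,
      normOn (linearPoincareFlow φ X t (φ (-t) y)) (S (φ (-t) y)) * |shear φ X (-t) ⟨y, v⟩| ≤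
        G * Real.exp (-(l / 2) * t) * ‖v‖ := by
  -- Half of the rate makes `K e^{-lτ/2} ≤ 1/2`; the other half remains as the decay, so domination
  -- over time `τ` gives the factor `(1/2) e^{-lτ/2}`.
  obtain ⟨τ, hτ, hKτ⟩ := exists_pos_mul_exp_le_half K (half_pos hl)
  obtain ⟨B, hB, hB'⟩ := h.splitting.continuous_right.exists_shear_bound hφ hX hcomp hinv hns τ
  have hexp (t : ℝ) : Real.exp (-l * t) = Real.exp (-(l / 2) * t) * Real.exp (-(l / 2) * t) := by
    rw [← Real.exp_add]; congr 1; ring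
  have hexp1 {t : ℝ} (ht : 0 ≤ t) : Real.exp (-(l / 2) * t) ≤ 1 := by
    rw [Real.exp_le_one_iff]
    nlinarith
  have hcon' : ∀ x ∈ Λ, ∀ t : ℝ, 0 ≤ t →
      normOn (linearPoincareFlow φ X t x) (S x) ≤ K * Real.exp (-(l / 2) * t) := by
    intro x hx t ht
    refine (hcon x hx t ht).trans (mul_le_mul_of_nonneg_left ?_ hK.le)
    rw [hexp]
    exact mul_le_of_le_one_right (Real.exp_pos _).le (hexp1 ht)
  refine ⟨2 * (K * B), by positivity, forall_nonneg_of_step hτ ?_ ?_⟩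
  · intro t ht htτ y hy v hv
    have h1 := hB' (-t) ⟨by linarith, by linarith⟩ y hy v hv
    have h2 := mul_le_mul (hcon' _ (hinv (-t) hy) t ht) h1 (abs_nonneg _) (by positivity)
    have h3 : 0 ≤ K * B * Real.exp (-(l / 2) * t) * ‖v‖ := by positivity
    linarith
  · intro s hs ih y hy v hv
    have hy' : φ (-τ) y ∈ Λ := hinv _ hy
    have e1 : φ (-(s + τ)) y = φ (-s) (φ (-τ) y) := by
      rw [← φ.map_add]; congr 1; ring
    have e2 : φ s (φ (-s) (φ (-τ) y)) = φ (-τ) y := by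
      rw [← φ.map_add, add_neg_cancel, φ.map_zero_apply]
    have e3 : φ τ (φ (-τ) y) = y := by
      rw [← φ.map_add, add_neg_cancel, φ.map_zero_apply]
    have h1 := hB' (-τ) ⟨le_rfl, by linarith⟩ y hy v hv
    have h2 := ih _ hy' _ (h.splitting.apply_mem_right hy (-τ) hv)
    have h3 : ‖linearPoincareFlow φ X (-τ) y v‖ ≤
      normOn (linearPoincareFlow φ X (-τ) y) (C y) * ‖v‖ := norm_le_normOn_mul hv
    have h4 (z : M) (hz : φ τ (φ (-τ) y) = z) :
        normOn (linearPoincareFlow φ X τ (φ (-τ) y)) (S (φ (-τ) y)) *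
          normOn (linearPoincareFlow φ X (-τ) z) (C z) ≤ K * Real.exp (-l * τ) := by
      subst hz
      exact hdom _ hy' τ hτ
    replace h4 := h4 y e3
    have h5 := h.splitting.normOn_linearPoincareFlow_add_le hφ hX (hinv (-s) hy') s τ e2
    have h6 := hcon' _ (hinv (-(s + τ)) hy) (s + τ) (by linarith)
    -- The shear over `-(s + τ)` is the shear `b` over `-τ` plus the shear `b'` over `-s` of `P_{-τ}
    -- v`. Contraction over `s + τ` handles `b`; for `b'`, the induction hypothesis takes the time
    -- `s` and domination the time `τ`.
    rw [neg_add s τ, shear_add hφ hX _ _ _ (hns _ (hinv _ (hinv _ hy))), ← neg_add s τ, e1] at *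
    rw [add_comm τ s] at h5
    have hs4 : Real.exp (-(l / 2) * (s + τ)) =
        Real.exp (-(l / 2) * s) * Real.exp (-(l / 2) * τ) := by
      rw [← Real.exp_add]; congr 1; ring
    rw [hexp] at h4
    set n := normOn (linearPoincareFlow φ X (s + τ) (φ (-s) (φ (-τ) y))) (S (φ (-s) (φ (-τ) y)))
    set nτ := normOn (linearPoincareFlow φ X τ (φ (-τ) y)) (S (φ (-τ) y))
    set ns := normOn (linearPoincareFlow φ X s (φ (-s) (φ (-τ) y))) (S (φ (-s) (φ (-τ) y)))
    set nC := normOn (linearPoincareFlow φ X (-τ) y) (C y)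
    set b := shear φ X (-τ) ⟨y, v⟩
    set b' := shear φ X (-s) ⟨φ (-τ) y, linearPoincareFlow φ X (-τ) y v⟩
    set N := ‖linearPoincareFlow φ X (-τ) y v‖
    set p := Real.exp (-(l / 2) * s)
    set q := Real.exp (-(l / 2) * τ)
    have hn : 0 ≤ n := normOn_nonneg
    have hnτ : 0 ≤ nτ := normOn_nonneg
    have hp : 0 < p := Real.exp_pos _
    have hq : 0 < q := Real.exp_pos _
    rw [hs4] at h6 ⊢
    calc n * |b + b'| ≤ n * (|b| + |b'|) := mul_le_mul_of_nonneg_left (abs_add_le _ _) hn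
      _ = n * |b| + n * |b'| := mul_add _ _ _
      _ ≤ K * (p * q) * (B * ‖v‖) + nτ * ns * |b'| :=
        add_le_add (mul_le_mul h6 h1 (abs_nonneg _) (by positivity))
          (mul_le_mul_of_nonneg_right h5 (abs_nonneg _))
      _ = K * B * (p * q) * ‖v‖ + nτ * (ns * |b'|) := by ring
      _ ≤ K * B * (p * q) * ‖v‖ + nτ * (2 * (K * B) * p * (nC * ‖v‖)) := by
        gcongr K * B * (p * q) * ‖v‖ + nτ * ?_
        exact h2.trans (mul_le_mul_of_nonneg_left h3 (by positivity))
      _ = K * B * (p * q) * ‖v‖ + 2 * (K * B) * p * (nτ * nC) * ‖v‖ := by ring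
      -- The two terms are now equal, which explains the constant `2 * (K * B)`.
      _ ≤ K * B * (p * q) * ‖v‖ + 2 * (K * B) * p * (1 / 2 * q) * ‖v‖ := by
        gcongr K * B * (p * q) * ‖v‖ + 2 * (K * B) * p * ?_ * ‖v‖
        refine h4.trans ?_
        rw [← mul_assoc]
        exact mul_le_mul_of_nonneg_right hKτ hq.le
      _ = 2 * (K * B) * (p * q) * ‖v‖ := by ring

end

/-! ### Lifting subbundles of the normal bundle. -/

section

variable {E : Type*} [NormedAddCommGroup E] [NormedSpace ℝ E]
  {M : Type*} [TopologicalSpace M] [ChartedSpace E M]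

variable [RiemannianBundle (fun x : M => TangentSpace 𝓘(ℝ, E) x)]
  {φ : Flow ℝ M} {X : ∀ x : M, TangentSpace 𝓘(ℝ, E) x} {Λ : Set M}
  {S C : ∀ x : M, Submodule ℝ (TangentSpace 𝓘(ℝ, E) x)}

/-- The vectors over a subbundle of the normal bundle whose image under `DX_t` loses its component
along the flow direction as `t → ∞`. -/
noncomputable def stableLift (φ : Flow ℝ M) (X : ∀ x : M, TangentSpace 𝓘(ℝ, E) x)
    (S : ∀ x : M, Submodule ℝ (TangentSpace 𝓘(ℝ, E) x)) (x : M) :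
    Submodule ℝ (TangentSpace 𝓘(ℝ, E) x) where
  carrier := {v | (normalSpace X x).starProjection v ∈ S x ∧
    Tendsto (fun t : ℝ => shear φ X t ⟨x, v⟩) atTop (𝓝 0)}
  add_mem' := by
    rintro v w ⟨hv, hv'⟩ ⟨hw, hw'⟩
    refine ⟨?_, ?_⟩
    · rw [map_add]
      exact Submodule.add_mem _ hv hw
    · simpa only [shear_add_vector, add_zero] using hv'.add hw'
  zero_mem' := by
    refine ⟨?_, ?_⟩
    · rw [map_zero]
      exact Submodule.zero_mem _
    · have h (t : ℝ) : shear φ X t ⟨x, 0⟩ = 0 := by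
        simpa using shear_smul (φ := φ) (X := X) t x 0 0
      simp only [h, tendsto_const_nhds]
  smul_mem' := by
    rintro a v ⟨hv, hv'⟩
    refine ⟨?_, ?_⟩
    · rw [map_smul]
      exact Submodule.smul_mem _ _ hv
    · simpa only [shear_smul, mul_zero] using hv'.const_mul a

/-- The sum of a subbundle of the normal bundle with the flow direction. -/
noncomputable def centralLift (X : ∀ x : M, TangentSpace 𝓘(ℝ, E) x)
    (C : ∀ x : M, Submodule ℝ (TangentSpace 𝓘(ℝ, E) x)) (x : M) :
    Submodule ℝ (TangentSpace 𝓘(ℝ, E) x) :=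
  (C x).comap
    ((normalSpace X x).starProjection : TangentSpace 𝓘(ℝ, E) x →ₗ[ℝ] TangentSpace 𝓘(ℝ, E) x)

lemma mem_centralLift {x : M} {v : TangentSpace 𝓘(ℝ, E) x} :
    v ∈ centralLift X C x ↔ (normalSpace X x).starProjection v ∈ C x := Iff.rfl

lemma generator_mem_centralLift (x : M) (a : ℝ) : a • X x ∈ centralLift X C x := by
  rw [mem_centralLift, starProjection_normalSpace_generator]
  exact Submodule.zero_mem _

lemma starProjection_tangentFlow (hφ : IsC1Flow (E := E) φ) (hX : IsGeneratedBy φ X) (t : ℝ)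
    (x : M) (v : TangentSpace 𝓘(ℝ, E) x) :
    (normalSpace X (φ t x)).starProjection (tangentFlow φ t x v) =
      linearPoincareFlow φ X t x ((normalSpace X x).starProjection v) := by
  rw [linearPoincareFlow_starProjection hφ hX, linearPoincareFlow_apply]

lemma shear_eq_add_axialCoeff (hφ : IsC1Flow (E := E) φ) (hX : IsGeneratedBy φ X) (t : ℝ)
    (x : M) (h : X (φ t x) ≠ 0) (v : TangentSpace 𝓘(ℝ, E) x) :
    shear φ X t ⟨x, v⟩ =
      shear φ X t ⟨x, (normalSpace X x).starProjection v⟩ + axialCoeff X ⟨x, v⟩ := by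
  conv_lhs => rw [eq_starProjection_add (X := X) v]
  rw [shear_add_vector, shear_generator hφ hX t x h]

/-- The shear of `v` is that of `Πv` plus the axial coefficient, and tends to zero; so the
coefficient is minus the limit of the shears of `Πv`. Thus the lift is a graph of uniformly bounded
slope. -/
lemma abs_axialCoeff_le_of_mem_stableLift (hφ : IsC1Flow (E := E) φ) (hX : IsGeneratedBy φ X)
    (hinv : IsInvariant φ Λ) (hns : ∀ x ∈ Λ, X x ≠ 0) {B : ℝ}
    (hB : ∀ t : ℝ, 0 ≤ t → ∀ x ∈ Λ, ∀ v ∈ S x, |shear φ X t ⟨x, v⟩| ≤ B * ‖v‖) {x : M} (hx : x ∈ Λ)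
    {v : TangentSpace 𝓘(ℝ, E) x} (hv : v ∈ stableLift φ X S x) :
    |axialCoeff X ⟨x, v⟩| ≤ B * ‖(normalSpace X x).starProjection v‖ := by
  have h1 : Tendsto (fun t : ℝ => |shear φ X t ⟨x, v⟩| + B * ‖(normalSpace X x).starProjection v‖)
      atTop (𝓝 (|0| + B * ‖(normalSpace X x).starProjection v‖)) :=
    hv.2.abs.add tendsto_const_nhds
  rw [abs_zero, zero_add] at h1
  refine ge_of_tendsto h1 ?_
  filter_upwards [eventually_ge_atTop 0] with t ht
  have h2 := hB t ht x hx _ hv.1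
  have h3 := shear_eq_add_axialCoeff hφ hX t x (hns _ (hinv t hx)) v
  have h4 : axialCoeff X ⟨x, v⟩ = shear φ X t ⟨x, v⟩ -
    shear φ X t ⟨x, (normalSpace X x).starProjection v⟩ := by linarith
  rw [h4]
  exact (abs_sub _ _).trans (by linarith)

lemma tangentFlow_mem_stableLift (hφ : IsC1Flow (E := E) φ) (hX : IsGeneratedBy φ X) (t : ℝ) {x : M}
    (hS : ∀ v ∈ S x, linearPoincareFlow φ X t x v ∈ S (φ t x)) {v : TangentSpace 𝓘(ℝ, E) x}
    (hv : v ∈ stableLift φ X S x) : tangentFlow φ t x v ∈ stableLift φ X S (φ t x) := by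
  refine ⟨?_, ?_⟩
  · rw [starProjection_tangentFlow hφ hX]
    exact hS _ hv.1
  · simp only [← shear_tangentFlow hφ]
    exact hv.2.comp (tendsto_atTop_add_const_right _ t tendsto_id)

lemma tangentFlow_mem_centralLift (hφ : IsC1Flow (E := E) φ) (hX : IsGeneratedBy φ X) (t : ℝ)
    {x : M} (hC : ∀ v ∈ C x, linearPoincareFlow φ X t x v ∈ C (φ t x)) {v : TangentSpace 𝓘(ℝ, E) x}
    (hv : v ∈ centralLift X C x) : tangentFlow φ t x v ∈ centralLift X C (φ t x) := by
  rw [mem_centralLift, starProjection_tangentFlow hφ hX]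
  exact hC _ hv

/-- The shear of `a • X x` is constantly `a`, so it tends to zero only for `a = 0`. -/
lemma eq_zero_of_smul_generator_mem_stableLift (hφ : IsC1Flow (E := E) φ) (hX : IsGeneratedBy φ X)
    {x : M} (h : ∀ t, X (φ t x) ≠ 0) {v : TangentSpace 𝓘(ℝ, E) x} (hv : v ∈ stableLift φ X S x)
    (hv0 : (normalSpace X x).starProjection v = 0) : v = 0 := by
  have h1 := eq_starProjection_add (X := X) v
  rw [hv0, zero_add] at h1
  have h2 := hv.2
  rw [h1] at h2
  simp only [shear_generator hφ hX _ x (h _)] at h2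
  rw [h1, tendsto_nhds_unique tendsto_const_nhds h2, zero_smul]

lemma starProjection_add_generator {x : M} {v : TangentSpace 𝓘(ℝ, E) x} (hv : v ∈ normalSpace X x)
    (a : ℝ) : (normalSpace X x).starProjection (v + a • X x) = v := by
  rw [map_add, starProjection_normalSpace_generator, add_zero, starProjection_of_mem hv]

/-- Every vector of a contracted invariant subbundle has a lift in `stableLift`. -/
lemma exists_add_smul_mem_stableLift (hφ : IsC1Flow (E := E) φ) (hX : IsGeneratedBy φ X)
    (hinv : IsInvariant φ Λ) (hns : ∀ x ∈ Λ, X x ≠ 0) {B K l : ℝ} (hBpos : 0 < B) (hl : 0 < l)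
    (hB : ∀ t : ℝ, 0 ≤ t → ∀ x ∈ Λ, ∀ v ∈ S x, |shear φ X t ⟨x, v⟩| ≤ B * ‖v‖)
    (hcon : ∀ x ∈ Λ, ∀ t : ℝ, 0 ≤ t →
      normOn (linearPoincareFlow φ X t x) (S x) ≤ K * Real.exp (-l * t))
    (hSinv : ∀ x ∈ Λ, ∀ t : ℝ, ∀ v ∈ S x, linearPoincareFlow φ X t x v ∈ S (φ t x))
    (hSN : ∀ x ∈ Λ, S x ≤ normalSpace X x) {x : M} (hx : x ∈ Λ) {v : TangentSpace 𝓘(ℝ, E) x}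
    (hv : v ∈ S x) : ∃ a : ℝ, v + a • X x ∈ stableLift φ X S x := by
  have hlim : Tendsto (fun t : ℝ => B * (K * Real.exp (-l * max t 0) * ‖v‖)) atTop (𝓝 0) := by
    have h1 : Tendsto (fun t : ℝ => -l * max t 0) atTop atBot :=
      (tendsto_atTop_mono (fun t => le_max_left t 0) tendsto_id).const_mul_atTop_of_neg
        (neg_lt_zero.2 hl)
    simpa using (((Real.tendsto_exp_atBot.comp h1).const_mul K).mul_const ‖v‖).const_mul B
  -- Truncation by `max t 0` confines the index to times where the estimates hold. By the cocycle
  -- identity, the difference between times `s ≤ t` is the shear over `t - s` of `P_s v`, which is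
  -- exponentially small in `s`.
  have hcau : CauchySeq fun t : ℝ => shear φ X (max t 0) ⟨x, v⟩ := by
    refine cauchySeq_of_le_tendsto_0' _ (fun s t hst => ?_) hlim
    have hs : 0 ≤ max s 0 := le_max_right _ _
    have hst' : max s 0 ≤ max t 0 := max_le_max_right 0 hst
    rw [dist_comm, Real.dist_eq]
    have h1 := shear_add hφ hX (max s 0) (max t 0 - max s 0) x (hns _ (hinv _ (hinv _ hx))) v
    rw [sub_add_cancel] at h1
    rw [h1, add_sub_cancel_left]
    refine (hB _ (sub_nonneg.2 hst') _ (hinv _ hx) _ (hSinv x hx _ v hv)).trans ?_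
    refine mul_le_mul_of_nonneg_left ?_ hBpos.le
    exact (norm_le_normOn_mul hv).trans
      (mul_le_mul_of_nonneg_right (hcon x hx _ hs) (norm_nonneg _))
  obtain ⟨a, ha⟩ := cauchySeq_tendsto_of_complete hcau
  refine ⟨-a, ?_, ?_⟩
  · rw [starProjection_add_generator (hSN x hx hv)]
    exact hv
  · have h1 : Tendsto (fun t : ℝ => shear φ X t ⟨x, v⟩) atTop (𝓝 a) := by
      refine ha.congr' ?_
      filter_upwards [eventually_ge_atTop 0] with t ht
      rw [max_eq_left ht]
    have h2 := h1.add_const (-a)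
    rw [add_neg_cancel] at h2
    refine h2.congr fun t => ?_
    rw [shear_add_vector, shear_generator hφ hX _ _ (hns _ (hinv _ hx))]

variable [IsManifold 𝓘(ℝ, E) 1 M]

lemma IsContinuousSubbundle.centralLift (hC : IsContinuousSubbundle Λ C)
    (hX : Continuous (fun x : M => (⟨x, X x⟩ : TangentBundle 𝓘(ℝ, E) M)))
    (hns : ∀ x ∈ Λ, X x ≠ 0) (hCN : ∀ x ∈ Λ, C x ≤ normalSpace X x) :
    IsContinuousSubbundle Λ (centralLift X C) := by
  intro x hx
  obtain ⟨U, hU, k, u, hu, hspan⟩ := hC x hx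
  have hcons (y : M) : (fun i => (Fin.cons X u : Fin (k + 1) → ∀ y, TangentSpace 𝓘(ℝ, E) y) i y) =
      (Fin.cons (X y) (fun i => u i y) : Fin (k + 1) → TangentSpace 𝓘(ℝ, E) y) := by
    ext i
    refine Fin.cases ?_ (fun i => ?_) i <;> rfl
  refine ⟨U, hU, k + 1, Fin.cons X u, fun i => ?_, fun y hy => ?_⟩
  · refine Fin.cases ?_ (fun i => ?_) i
    · exact hX.continuousOn
    · exact hu i
  rw [hcons, linearIndependent_finCons, (hspan y hy).2]
  refine ⟨⟨(hspan y hy).1, fun hXC => hns y hy.2 (generator_mem_normalSpace (hCN y hy.2 hXC))⟩, ?_⟩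
  rw [Fin.range_cons, Submodule.span_insert, (hspan y hy).2]
  apply le_antisymm
  · refine sup_le ?_ fun v hv => ?_
    · rw [Submodule.span_singleton_le_iff_mem]
      simpa using generator_mem_centralLift (C := C) (X := X) y 1
    · rw [mem_centralLift, starProjection_of_mem (hCN y hy.2 hv)]
      exact hv
  · intro v hv
    rw [eq_starProjection_add (X := X) v, add_comm]
    exact Submodule.add_mem_sup
      (Submodule.smul_mem _ _ (Submodule.mem_span_singleton_self _)) hv

variable [IsContinuousRiemannianBundle E (fun x : M => TangentSpace 𝓘(ℝ, E) x)]

/-- The axial coefficients of the lifted frame are locally uniform limits of the continuous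
functions `-σ_s(u_i)`, hence continuous. -/
lemma IsContinuousSubbundle.stableLift (hS : IsContinuousSubbundle Λ S)
    (hφ : IsC1Flow (E := E) φ) (hX : IsGeneratedBy φ X)
    (hinv : IsInvariant φ Λ) (hns : ∀ x ∈ Λ, X x ≠ 0) {B K l : ℝ} (hBpos : 0 < B) (hK : 0 < K)
    (hl : 0 < l)
    (hB : ∀ t : ℝ, 0 ≤ t → ∀ x ∈ Λ, ∀ v ∈ S x, |shear φ X t ⟨x, v⟩| ≤ B * ‖v‖)
    (hcon : ∀ x ∈ Λ, ∀ t : ℝ, 0 ≤ t →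
      normOn (linearPoincareFlow φ X t x) (S x) ≤ K * Real.exp (-l * t))
    (hSinv : ∀ x ∈ Λ, ∀ t : ℝ, ∀ v ∈ S x, linearPoincareFlow φ X t x v ∈ S (φ t x))
    (hSN : ∀ x ∈ Λ, S x ≤ normalSpace X x) :
    IsContinuousSubbundle Λ (stableLift φ X S) := by
  have hXc := hφ.continuous_generator hX
  have hex : ∀ (x : M) (v : TangentSpace 𝓘(ℝ, E) x), ∃ a : ℝ, x ∈ Λ → v ∈ S x →
      v + a • X x ∈ FlowSplitting.stableLift φ X S x := by
    intro x v
    by_cases h : x ∈ Λ ∧ v ∈ S x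
    · obtain ⟨a, ha⟩ := exists_add_smul_mem_stableLift hφ hX hinv hns hBpos hl hB hcon hSinv hSN
        h.1 h.2
      exact ⟨a, fun _ _ => ha⟩
    · exact ⟨0, fun h1 h2 => absurd ⟨h1, h2⟩ h⟩
  choose a ha using hex
  intro x hx
  obtain ⟨U, hU, k, u, hu, hspan⟩ := hS x hx
  have huS {y : M} (hy : y ∈ U ∩ Λ) (i : Fin k) : u i y ∈ S y := by
    rw [← (hspan y hy).2]
    exact Submodule.subset_span ⟨i, rfl⟩
  -- The rate of convergence is the slope bound at `X_s(y)`: the image of the lifted vector has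
  -- axial coefficient `a + σ_s(u_i)` and normal part `P_s u_i`.
  have hest (i : Fin k) {y : M} (hy : y ∈ U ∩ Λ) {s : ℝ} (hs : 0 ≤ s) :
      |a y (u i y) + shear φ X s ⟨y, u i y⟩| ≤ B * (K * Real.exp (-l * s) * ‖u i y‖) := by
    have h1 := ha y (u i y) hy.2 (huS hy i)
    have h2 := tangentFlow_mem_stableLift hφ hX s (hSinv y hy.2 s) h1
    have h3 := abs_axialCoeff_le_of_mem_stableLift hφ hX hinv hns hB (hinv s hy.2) h2
    rw [starProjection_tangentFlow hφ hX,
      starProjection_add_generator (hSN y hy.2 (huS hy i))] at h3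
    have h4 : shear φ X s ⟨y, u i y + a y (u i y) • X y⟩ =
        a y (u i y) + shear φ X s ⟨y, u i y⟩ := by
      rw [shear_add_vector, shear_generator hφ hX _ _ (hns _ (hinv s hy.2)), add_comm]
    rw [← h4]
    refine h3.trans (mul_le_mul_of_nonneg_left ?_ hBpos.le)
    exact (norm_le_normOn_mul (huS hy i)).trans
      (mul_le_mul_of_nonneg_right (hcon y hy.2 s hs) (norm_nonneg _))
  have hshear (i : Fin k) (s : ℝ) : ContinuousOn (fun y => shear φ X s ⟨y, u i y⟩) (U ∩ Λ) := by
    refine continuousOn_axialCoeff (f := φ s) hXc (fun y hy => hns _ (hinv s hy.2)) ?_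
    exact hφ.continuous_tangentFlow.comp_continuousOn
      (f := fun y : M => (s, (⟨y, u i y⟩ : TangentBundle 𝓘(ℝ, E) M)))
      (continuousOn_const.prodMk (hu i))
  have hacont (i : Fin k) : ContinuousOn (fun y => a y (u i y)) (U ∩ Λ) := by
    intro y hy
    refine continuousWithinAt_of_locally_uniform_approx_of_continuousWithinAt hy fun V hV => ?_
    obtain ⟨ε, hε, hεV⟩ := Metric.mem_uniformity_dist.1 hV
    set R := ‖u i y‖ + 1
    have hlim : Tendsto (fun s : ℝ => B * (K * Real.exp (-l * s) * R)) atTop (𝓝 0) := by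
      have h1 : Tendsto (fun t : ℝ => -l * t) atTop atBot :=
        tendsto_id.const_mul_atTop_of_neg (neg_lt_zero.2 hl)
      simpa using (((Real.tendsto_exp_atBot.comp h1).const_mul K).mul_const R).const_mul B
    obtain ⟨s, hs, hs0⟩ :=
      ((hlim.eventually (gt_mem_nhds hε)).and (eventually_ge_atTop 0)).exists
    have hR : ∀ᶠ z in 𝓝[U ∩ Λ] y, ‖u i z‖ < R :=
      (continuousOn_norm_bundle (hu i) y hy).tendsto (Iio_mem_nhds (lt_add_one _))
    refine ⟨_, hR.and self_mem_nhdsWithin, fun z => -shear φ X s ⟨z, u i z⟩,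
      (hshear i s y hy).neg, fun z hz => hεV ?_⟩
    rw [Real.dist_eq, sub_neg_eq_add]
    refine (hest i hz.2 hs0).trans_lt (lt_of_le_of_lt ?_ hs)
    exact mul_le_mul_of_nonneg_left (mul_le_mul_of_nonneg_left hz.1.le (by positivity)) hBpos.le
  refine ⟨U, hU, k, fun i y => u i y + a y (u i y) • X y, fun i => ?_, fun y hy => ?_⟩
  · exact continuousOn_section_add (hu i) (continuousOn_section_smul (hacont i) hXc.continuousOn)
  have hproj (i : Fin k) :
      (normalSpace X y).starProjection (u i y + a y (u i y) • X y) = u i y :=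
    starProjection_add_generator (hSN y hy.2 (huS hy i)) _
  refine ⟨?_, le_antisymm ?_ fun v hv => ?_⟩
  · refine LinearIndependent.of_comp ((normalSpace X y).starProjection :
      TangentSpace 𝓘(ℝ, E) y →ₗ[ℝ] TangentSpace 𝓘(ℝ, E) y) ?_
    have : (((normalSpace X y).starProjection :
        TangentSpace 𝓘(ℝ, E) y →ₗ[ℝ] TangentSpace 𝓘(ℝ, E) y) ∘
        fun i => u i y + a y (u i y) • X y) = fun i => u i y := funext hproj
    rw [this]
    exact (hspan y hy).1
  · rw [Submodule.span_le]
    rintro _ ⟨i, rfl⟩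
    exact ha y _ hy.2 (huS hy i)
  · have h1 := hv.1
    rw [← (hspan y hy).2, Submodule.mem_span_range_iff_exists_fun] at h1
    obtain ⟨d, hd⟩ := h1
    have h2 : ∑ i, d i • (u i y + a y (u i y) • X y) ∈ FlowSplitting.stableLift φ X S y :=
      Submodule.sum_mem _ fun i _ => Submodule.smul_mem _ _ (ha y _ hy.2 (huS hy i))
    -- Two lifts of the same normal vector differ by a multiple of `X`, and the lifted bundle
    -- contains no such nonzero multiple.
    have h3 : (normalSpace X y).starProjection
        (v - ∑ i, d i • (u i y + a y (u i y) • X y)) = 0 := by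
      rw [map_sub, map_sum]
      simp only [map_smul, hproj]
      rw [hd, sub_self]
    have h4 := eq_zero_of_smul_generator_mem_stableLift hφ hX (fun t => hns _ (hinv t hy.2))
      (Submodule.sub_mem _ hv h2) h3
    rw [sub_eq_zero.1 h4]
    exact Submodule.sum_mem _ fun i _ => Submodule.smul_mem _ _ (Submodule.subset_span ⟨i, rfl⟩)

end

/-! ### From a splitting for the Poincaré flow to one for the derivative. -/

section

variable {E : Type*} [NormedAddCommGroup E] [NormedSpace ℝ E]
  {M : Type*} [TopologicalSpace M] [ChartedSpace E M]

variable [RiemannianBundle (fun x : M => TangentSpace 𝓘(ℝ, E) x)]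
  {φ : Flow ℝ M} {X : ∀ x : M, TangentSpace 𝓘(ℝ, E) x} {Λ : Set M}
  {S C : ∀ x : M, Submodule ℝ (TangentSpace 𝓘(ℝ, E) x)}

/-- The image stays in the lifted bundle, so the slope bound at `X_t(x)` makes its flow component at
most `B * D` times its normal component. -/
lemma normOn_tangentFlow_stableLift_le (hφ : IsC1Flow (E := E) φ) (hX : IsGeneratedBy φ X)
    (hinv : IsInvariant φ Λ) (hns : ∀ x ∈ Λ, X x ≠ 0) {B D : ℝ} (hBpos : 0 < B) (hD : 0 < D)
    (hB : ∀ t : ℝ, 0 ≤ t → ∀ x ∈ Λ, ∀ v ∈ S x, |shear φ X t ⟨x, v⟩| ≤ B * ‖v‖)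
    (hXD : ∀ x ∈ Λ, ‖X x‖ ≤ D)
    (hSinv : ∀ x ∈ Λ, ∀ t : ℝ, ∀ v ∈ S x, linearPoincareFlow φ X t x v ∈ S (φ t x))
    {x : M} (hx : x ∈ Λ) (t : ℝ) :
    normOn (tangentFlow φ t x) (stableLift φ X S x) ≤
      (1 + B * D) * normOn (linearPoincareFlow φ X t x) (S x) := by
  refine normOn_le (mul_nonneg (by positivity) normOn_nonneg) fun v hv => ?_
  have h1 := abs_axialCoeff_le_of_mem_stableLift hφ hX hinv hns hB (hinv t hx)
    (tangentFlow_mem_stableLift hφ hX t (hSinv x hx t) hv)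
  rw [starProjection_tangentFlow hφ hX] at h1
  have h2 : ‖linearPoincareFlow φ X t x ((normalSpace X x).starProjection v)‖ ≤
      normOn (linearPoincareFlow φ X t x) (S x) * ‖v‖ :=
    (norm_le_normOn_mul hv.1).trans
      (mul_le_mul_of_nonneg_left (norm_starProjection_le v) normOn_nonneg)
  rw [eq_starProjection_add (X := X) (tangentFlow φ t x v), starProjection_tangentFlow hφ hX]
  set N := ‖linearPoincareFlow φ X t x ((normalSpace X x).starProjection v)‖
  refine (norm_add_le _ _).trans ?_
  rw [norm_smul, Real.norm_eq_abs]
  calc _ ≤ N + B * N * D := add_le_add le_rfl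
        (mul_le_mul h1 (hXD _ (hinv t hx)) (norm_nonneg _) (by positivity))
    _ = (1 + B * D) * N := by ring
    _ ≤ (1 + B * D) * (normOn (linearPoincareFlow φ X t x) (S x) * ‖v‖) :=
        mul_le_mul_of_nonneg_left h2 (by positivity)
    _ = _ := (mul_assoc _ _ _).symm

lemma centralLift_ne_bot {x : M} (h : X x ≠ 0) : centralLift X C x ≠ ⊥ := fun hbot =>
  h ((Submodule.eq_bot_iff _).1 hbot _ (by simpa using generator_mem_centralLift (C := C) x 1))

/-- The lift contains the flow line strictly, since a nonzero normal vector is not a multiple of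
`X`. -/
lemma two_le_finrank_centralLift [FiniteDimensional ℝ E] {x : M} (h : X x ≠ 0)
    (hCN : C x ≤ normalSpace X x) (hC : C x ≠ ⊥) :
    2 ≤ Module.finrank ℝ (centralLift X C x) := by
  obtain ⟨v, hv, hv0⟩ := Submodule.exists_mem_ne_zero_of_ne_bot hC
  have hfin : FiniteDimensional ℝ (TangentSpace 𝓘(ℝ, E) x) := inferInstanceAs (FiniteDimensional ℝ E)
  have hlt : Submodule.span ℝ {X x} < centralLift X C x := by
    refine lt_of_le_of_ne ?_ fun heq => ?_
    · rw [Submodule.span_singleton_le_iff_mem]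
      simpa using generator_mem_centralLift (C := C) (X := X) x 1
    · have h1 : v ∈ centralLift X C x := by
        rw [mem_centralLift, starProjection_of_mem (hCN hv)]
        exact hv
      rw [← heq] at h1
      obtain ⟨a, rfl⟩ := Submodule.mem_span_singleton.1 h1
      have h2 := starProjection_normalSpace_generator (X := X) (x := x) a
      rw [starProjection_of_mem (hCN hv)] at h2
      exact hv0 h2
  have h1 := Submodule.finrank_lt_finrank_of_lt hlt
  rw [finrank_span_singleton h] at h1
  exact h1

variable [IsManifold 𝓘(ℝ, E) 1 M]
  [IsContinuousRiemannianBundle E (fun x : M => TangentSpace 𝓘(ℝ, E) x)]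

theorem IsPoincarePHSplitting.lift (h : IsPoincarePHSplitting φ X Λ S C)
    (hφ : IsC1Flow (E := E) φ) (hX : IsGeneratedBy φ X) (hcomp : IsCompact Λ)
    (hinv : IsInvariant φ Λ) (hns : ∀ x ∈ Λ, X x ≠ 0) :
    IsPartiallyHyperbolicSplitting φ (tangentFlow φ) Λ (fun _ => ⊤) (stableLift φ X S)
      (centralLift X C) := by
  have hXc := hφ.continuous_generator hX
  obtain ⟨m, hm, D, hD, hmD⟩ := exists_norm_bounds hXc hcomp hns
  obtain ⟨K, hK, l, hl, hcon, hdom⟩ := IsPartiallyHyperbolicSplitting.exists_rate h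
  obtain ⟨B, hBpos, hB⟩ := h.exists_shear_bound_left hφ hX hcomp hinv hns
  obtain ⟨G, hG, hG'⟩ := h.exists_shear_bound_right hφ hX hcomp hinv hns hK hl hcon hdom
  have hSinv : ∀ x ∈ Λ, ∀ t : ℝ, ∀ v ∈ S x, linearPoincareFlow φ X t x v ∈ S (φ t x) :=
    fun x hx t v hv => h.splitting.apply_mem_left hx t hv
  have hCinv : ∀ x ∈ Λ, ∀ t : ℝ, ∀ v ∈ C x, linearPoincareFlow φ X t x v ∈ C (φ t x) :=
    fun x hx t v hv => h.splitting.apply_mem_right hx t hv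
  have hSN : ∀ x ∈ Λ, S x ≤ normalSpace X x := fun x hx => h.splitting.left_le hx
  have hCN : ∀ x ∈ Λ, C x ≤ normalSpace X x := fun x hx => h.splitting.right_le hx
  have hex {x : M} (hx : x ∈ Λ) {v : TangentSpace 𝓘(ℝ, E) x} (hv : v ∈ S x) :=
    exists_add_smul_mem_stableLift hφ hX hinv hns hBpos hl hB hcon hSinv hSN hx hv
  have hle {x : M} (hx : x ∈ Λ) (t : ℝ) :=
    normOn_tangentFlow_stableLift_le hφ hX hinv hns hBpos hD hB (fun x hx => (hmD x hx).2)
      hSinv hx t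
  have hBD : 0 < 1 + B * D := by positivity
  have hexp {t : ℝ} (ht : 0 ≤ t) : Real.exp (-l * t) ≤ Real.exp (-(l / 2) * t) :=
    Real.exp_le_exp.2 (by nlinarith)
  refine ⟨⟨?_, ?_, ?_, ?_, ?_, ?_⟩, ?_, ?_, ?_⟩
  · intro x hx
    rw [eq_top_iff]
    intro v _
    have hv : (normalSpace X x).starProjection v ∈ S x ⊔ C x := by
      rw [h.splitting.sup_eq x hx]
      exact Submodule.starProjection_apply_mem _ _
    obtain ⟨e, he, f, hf, hef⟩ := Submodule.mem_sup.1 hv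
    obtain ⟨a, ha⟩ := hex hx he
    -- Subtracting the lift of the `S`-part of `Πv` leaves a vector whose projection is the
    -- `C`-part.
    refine Submodule.mem_sup.2 ⟨_, ha, v - (e + a • X x), ?_, add_sub_cancel _ _⟩
    rw [mem_centralLift, map_sub, starProjection_add_generator (hSN x hx he), ← hef,
      add_sub_cancel_left]
    exact hf
  · intro x hx
    rw [Submodule.disjoint_def]
    intro v hv hv'
    exact eq_zero_of_smul_generator_mem_stableLift hφ hX (fun t => hns _ (hinv t hx)) hv
      (Submodule.disjoint_def.1 (h.splitting.disjoint x hx) _ hv.1 hv')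
  · exact h.splitting.continuous_left.stableLift hφ hX hinv hns hBpos hK hl hB hcon hSinv hSN
  · exact h.splitting.continuous_right.centralLift hXc hns hCN
  · exact map_tangentFlow_eq hφ hinv fun x hx t v hv =>
      tangentFlow_mem_stableLift hφ hX t (hSinv x hx t) hv
  · exact map_tangentFlow_eq hφ hinv fun x hx t v hv =>
      tangentFlow_mem_centralLift hφ hX t (hCinv x hx t) hv
  -- `1 + B * D` comes from the graph `E`; the final `1` only makes the inequality strict.
  · refine ⟨(1 + B * D) * (K + D * (G + K * m⁻¹)) + 1, by positivity, l / 2, half_pos hl,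
      fun x hx t ht => ?_⟩
    have e : φ (-t) (φ t x) = x := by
      rw [← φ.map_add, neg_add_cancel, φ.map_zero_apply]
    have hG'' := hG' t ht.le _ (hinv t hx)
    rw [e] at hG''
    have hd := hdom x hx t ht
    have hc := hcon x hx t ht.le
    have hq := hexp ht.le
    set q := Real.exp (-(l / 2) * t)
    have hq0 : 0 < q := Real.exp_pos _
    -- `DX_{-t} v` has three parts: `P_{-t} v`, controlled by domination; the shear of `Πv`, by `G`;
    -- and the axial coefficient of `v`, which does not grow and is absorbed by the contraction of
    -- `S`.
    have key : normOn (linearPoincareFlow φ X t x) (S x) *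
        normOn (tangentFlow φ (-t) (φ t x)) (centralLift X C (φ t x)) ≤
        (K + D * (G + K * m⁻¹)) * q := by
      refine mul_normOn_le normOn_nonneg (by positivity) fun v hv => ?_
      have hv' : (normalSpace X (φ t x)).starProjection v ∈ C (φ t x) := hv
      have h1 : ‖linearPoincareFlow φ X (-t) (φ t x) v‖ ≤
          normOn (linearPoincareFlow φ X (-t) (φ t x)) (C (φ t x)) * ‖v‖ := by
        rw [← linearPoincareFlow_starProjection hφ hX]
        exact (norm_le_normOn_mul hv').trans
          (mul_le_mul_of_nonneg_left (norm_starProjection_le v) normOn_nonneg)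
      have h2 := (hG'' _ hv').trans
        (mul_le_mul_of_nonneg_left (norm_starProjection_le v) (by positivity))
      have h3 := abs_axialCoeff_le v hm (hmD _ (hinv t hx)).1
      have h4 := shear_eq_add_axialCoeff hφ hX (-t) (φ t x) (hns _ (hinv _ (hinv _ hx))) v
      have h5 := (hmD _ (hinv (-t) (hinv t hx))).2
      rw [tangentFlow_eq_add_shear (X := X), h4]
      set n := normOn (linearPoincareFlow φ X t x) (S x)
      set nC := normOn (linearPoincareFlow φ X (-t) (φ t x)) (C (φ t x))
      set b := shear φ X (-t) ⟨φ t x, (normalSpace X (φ t x)).starProjection v⟩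
      set c := axialCoeff X ⟨φ t x, v⟩
      have hn : 0 ≤ n := normOn_nonneg
      have h6 : ‖linearPoincareFlow φ X (-t) (φ t x) v + (b + c) • X (φ (-t) (φ t x))‖ ≤
          nC * ‖v‖ + (|b| + |c|) * D := by
        refine (norm_add_le _ _).trans (add_le_add h1 ?_)
        rw [norm_smul, Real.norm_eq_abs]
        exact mul_le_mul (abs_add_le _ _) h5 (norm_nonneg _) (by positivity)
      calc _ ≤ n * (nC * ‖v‖ + (|b| + |c|) * D) := mul_le_mul_of_nonneg_left h6 hn
        _ = (n * nC) * ‖v‖ + D * (n * |b| + n * |c|) := by ring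
        _ ≤ (K * q) * ‖v‖ + D * (G * q * ‖v‖ + (K * q) * (m⁻¹ * ‖v‖)) := by
          refine add_le_add (mul_le_mul_of_nonneg_right (hd.trans
            (mul_le_mul_of_nonneg_left hq hK.le)) (norm_nonneg _))
            (mul_le_mul_of_nonneg_left (add_le_add h2 ?_) hD.le)
          exact mul_le_mul (hc.trans (mul_le_mul_of_nonneg_left hq hK.le)) h3 (abs_nonneg _)
            (by positivity)
        _ = _ := by ring
    calc _ ≤ ((1 + B * D) * normOn (linearPoincareFlow φ X t x) (S x)) *
          normOn (tangentFlow φ (-t) (φ t x)) (centralLift X C (φ t x)) :=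
          mul_le_mul_of_nonneg_right (hle hx t) normOn_nonneg
      _ = (1 + B * D) * (normOn (linearPoincareFlow φ X t x) (S x) *
          normOn (tangentFlow φ (-t) (φ t x)) (centralLift X C (φ t x))) := mul_assoc _ _ _
      _ ≤ (1 + B * D) * ((K + D * (G + K * m⁻¹)) * q) := mul_le_mul_of_nonneg_left key hBD.le
      _ < _ := by
        rw [← mul_assoc, add_mul _ 1 q, one_mul]
        exact lt_add_of_pos_right _ hq0
  · refine ⟨(1 + B * D) * K, by positivity, l, hl, fun x hx t ht => (hle hx t).trans ?_⟩
    rw [mul_assoc]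
    exact mul_le_mul_of_nonneg_left (hcon x hx t ht) hBD.le
  · intro x hx hbot
    refine h.left_ne_bot x hx ((Submodule.eq_bot_iff _).2 fun v hv => ?_)
    obtain ⟨a, ha⟩ := hex hx hv
    rw [← starProjection_add_generator (hSN x hx hv) a, (Submodule.eq_bot_iff _).1 hbot _ ha,
      map_zero]

end

end FlowSplitting

theorem corollary2p3
    {E : Type*} [NormedAddCommGroup E] [NormedSpace ℝ E] [FiniteDimensional ℝ E]
    {M : Type*} [TopologicalSpace M] [T2Space M] [CompactSpace M] [ChartedSpace E M]
    [IsManifold 𝓘(ℝ, E) ∞ M]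
    [RiemannianBundle (fun x : M => TangentSpace 𝓘(ℝ, E) x)]
    [IsContMDiffRiemannianBundle 𝓘(ℝ, E) ∞ E (fun x : M => TangentSpace 𝓘(ℝ, E) x)]
    (φ : Flow ℝ M) (X : ∀ x : M, TangentSpace 𝓘(ℝ, E) x)
    (hφ : FlowSplitting.IsC1Flow (E := E) φ)
    (hX : FlowSplitting.IsGeneratedBy φ X)
    (Λ : Set M) (hcomp : IsCompact Λ) (hinv : IsInvariant φ Λ)
    (hns : ∀ x ∈ Λ, X x ≠ 0) :
    ((∃ S C : ∀ x : M, Submodule ℝ (TangentSpace 𝓘(ℝ, E) x),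
        FlowSplitting.IsFlowPHSplitting φ Λ S C) ↔
      ∃ S C : ∀ x : M, Submodule ℝ (TangentSpace 𝓘(ℝ, E) x),
        FlowSplitting.IsPoincarePHSplitting φ X Λ S C) ∧
    ((∃ S C : ∀ x : M, Submodule ℝ (TangentSpace 𝓘(ℝ, E) x),
        FlowSplitting.IsFlowPHSplitting φ Λ S C ∧ ∀ x ∈ Λ, 2 ≤ Module.finrank ℝ (C x)) ↔
      ∃ S C : ∀ x : M, Submodule ℝ (TangentSpace 𝓘(ℝ, E) x),
        FlowSplitting.IsPoincarePHSplitting φ X Λ S C ∧ ∀ x ∈ Λ, C x ≠ ⊥) := by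
  have : IsContinuousRiemannianBundle E (fun x : M => TangentSpace 𝓘(ℝ, E) x) := by
    obtain ⟨g, hg, h⟩ := IsContMDiffRiemannianBundle.exists_contMDiff (IB := 𝓘(ℝ, E)) (n := ∞)
      (F := E) (E := fun x : M => TangentSpace 𝓘(ℝ, E) x)
    exact ⟨g, hg.continuous, h⟩
  refine ⟨⟨?_, ?_⟩, ?_, ?_⟩
  · rintro ⟨S, C, h, -⟩
    exact ⟨_, _, h.normalPart hφ hX hcomp hinv hns⟩
  · rintro ⟨S, C, h⟩
    exact ⟨_, _, h.lift hφ hX hcomp hinv hns,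
      fun x hx => FlowSplitting.centralLift_ne_bot (hns x hx)⟩
  · rintro ⟨S, C, ⟨h, -⟩, hC⟩
    exact ⟨_, _, h.normalPart hφ hX hcomp hinv hns,
      fun x hx => FlowSplitting.normalPart_ne_bot (hC x hx)⟩
  · rintro ⟨S, C, h, hC⟩
    exact ⟨_, _, ⟨h.lift hφ hX hcomp hinv hns,
      fun x hx => FlowSplitting.centralLift_ne_bot (hns x hx)⟩, fun x hx =>
      FlowSplitting.two_le_finrank_centralLift (hns x hx) (h.splitting.right_le hx) (hC x hx)⟩
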